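/- Let $N\ge 1$, let $\Omega\subset\mathbb{R}^N$ be a bounded domain, $T>0$, $Q=(0,T)\times\Omega$, $1<p<\infty$ and $p'=p/(p-1)$. Let $V=W^{1,p}_0(\Omega)\cap L^2(\Omega)$ with dual $V'$, and let $$W=\{u\in L^p(0,T;V) : u_t\in L^{p'}(0,T;V')\},\qquad \|u\|_W=\|u\|_{L^p(0,T;V)}+\|u_t\|_{L^{p'}(0,T;V')}.$$ The parabolic $p$-capacity of an open set $U\subset Q$ is $$\operatorname{cap}_p(U)=\inf\{\|u\|_W : u\in W,\ u\ge\chi_U \text{ a.e. in } Q\}$$ (with $\inf\emptyset=+\infty$), and that of a Borel set $B\subset Q$ is $\operatorname{cap}_p(B)=\inf\{\operatorname{cap}_p(U) : B\subset U\subset Q,\ U \text{ open}\}$. Let $\mu$ be a finite (signed) Radon measure in $Q$, and suppose that there exist $f\in L^1(Q)$, $g\in L^p(0,T;V)\cap L^\infty(Q)$ and $\chi\in L^{p'}(0,T;W^{-1,p'}(\Omega))$, where $W^{-1,p'}(\Omega)$ is the dual of $W^{1,p}_0(\Omega)$, such that $$\mu=f+g_t+\chi\quad\text{in }\mathcal{D}'(Q),$$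 that is, for every $\varphi\in C_c^\infty(Q)$, $$\int_Q\varphi\,d\mu=\int_Q f\varphi\,dx\,dt-\int_Q g\,\varphi_t\,dx\,dt+\int_0^T\langle\chi(t),\varphi(t,\cdot)\rangle\,dt.$$ Then $\mu$ is diffuse, that is, $\mu(E)=0$ for every Borel set $E\subset Q$ with $\operatorname{cap}_p(E)=0$. -/

import Mathlib

open MeasureTheory Set TopologicalSpace
open scoped ENNReal Distributions ContDiff

noncomputable section

namespace ParabolicCapacity

/-- Euclidean space `ℝ^N`. -/
abbrev Euc (N : ℕ) : Type := EuclideanSpace ℝ (Fin N)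

variable {N : ℕ}

/-- Lebesgue measure on `Ω ⊆ ℝ^N`. -/
abbrev spaceMeasure (Ω : Opens (Euc N)) : Measure (Euc N) :=
  volume.restrict (Ω : Set (Euc N))

/-- Lebesgue measure on the time interval `(0, T)`. -/
abbrev timeMeasure (T : ℝ) : Measure ℝ := volume.restrict (Ioo 0 T)

/-- The parabolic cylinder `Q = (0, T) × Ω`, as an open subset of `ℝ × ℝ^N`. -/
def cylinder (T : ℝ) (Ω : Opens (Euc N)) : Opens (ℝ × Euc N) :=
  ⟨Ioo 0 T ×ˢ (Ω : Set (Euc N)), isOpen_Ioo.prod Ω.isOpen⟩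

/-- Lebesgue measure `dx dt` on the cylinder `Q`. -/
abbrev cylinderMeasure (T : ℝ) (Ω : Opens (Euc N)) : Measure (ℝ × Euc N) :=
  volume.restrict (cylinder T Ω : Set (ℝ × Euc N))

/-! ### The spaces `W₀^{1,p}(Ω)` and `V = W₀^{1,p}(Ω) ∩ L²(Ω)` -/

theorem continuous_gradient {Ω : Opens (Euc N)} (ψ : 𝓓(Ω, ℝ)) : Continuous (gradient ψ) :=
  (InnerProductSpace.toDual ℝ (Euc N)).symm.continuous.comp
    (ψ.contDiff.continuous_fderiv (by simp))

theorem memLp_test {Ω : Opens (Euc N)} (r : ℝ≥0∞) (ψ : 𝓓(Ω, ℝ)) :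
    MemLp ψ r (spaceMeasure Ω) :=
  ψ.continuous.memLp_of_hasCompactSupport ψ.hasCompactSupport

theorem memLp_gradient {Ω : Opens (Euc N)} (r : ℝ≥0∞) (ψ : 𝓓(Ω, ℝ)) :
    MemLp (gradient ψ) r (spaceMeasure Ω) := by
  refine (continuous_gradient ψ).memLp_of_hasCompactSupport ?_
  exact (ψ.hasCompactSupport.fderiv ℝ).comp_left (map_zero _)

theorem gradient_add_test {Ω : Opens (Euc N)} (ψ₁ ψ₂ : 𝓓(Ω, ℝ)) :
    gradient (ψ₁ + ψ₂ : 𝓓(Ω, ℝ)) = gradient ψ₁ + gradient ψ₂ := by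
  funext x
  have h₁ : DifferentiableAt ℝ ψ₁ x := (ψ₁.contDiff.differentiable (by simp)) x
  have h₂ : DifferentiableAt ℝ ψ₂ x := (ψ₂.contDiff.differentiable (by simp)) x
  have h : ((ψ₁ + ψ₂ : 𝓓(Ω, ℝ)) : Euc N → ℝ) = ψ₁ + ψ₂ := rfl
  simp only [gradient, h, fderiv_add h₁ h₂, map_add, Pi.add_apply]

theorem gradient_smul_test {Ω : Opens (Euc N)} (c : ℝ) (ψ : 𝓓(Ω, ℝ)) :
    gradient (c • ψ : 𝓓(Ω, ℝ)) = c • gradient ψ := by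
  funext x
  have h₁ : DifferentiableAt ℝ ψ x := (ψ.contDiff.differentiable (by simp)) x
  have h : ((c • ψ : 𝓓(Ω, ℝ)) : Euc N → ℝ) = c • (ψ : Euc N → ℝ) := rfl
  simp only [gradient, h, fderiv_const_smul h₁, map_smul, Pi.smul_apply]

/-- The pairs `(u, G) ∈ L^p(Ω) × L^p(Ω; ℝ^N)` with the norm `‖u‖_p + ‖G‖_p`.  The Sobolev space
`W^{1,p}(Ω)` is isometrically the closed subspace of the pairs `(u, ∇u)`, with the weak
gradient `∇u`. -/
def SobolevPair (Ω : Opens (Euc N)) (p : ℝ≥0∞) [Fact (1 ≤ p)] : Type :=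
  WithLp 1 (Lp ℝ p (spaceMeasure Ω) × Lp (Euc N) p (spaceMeasure Ω))

section SobolevPair

variable (Ω : Opens (Euc N)) (p : ℝ≥0∞) [Fact (1 ≤ p)]

instance : NormedAddCommGroup (SobolevPair Ω p) :=
  inferInstanceAs
    (NormedAddCommGroup (WithLp 1 (Lp ℝ p (spaceMeasure Ω) × Lp (Euc N) p (spaceMeasure Ω))))

instance : NormedSpace ℝ (SobolevPair Ω p) :=
  inferInstanceAs
    (NormedSpace ℝ (WithLp 1 (Lp ℝ p (spaceMeasure Ω) × Lp (Euc N) p (spaceMeasure Ω))))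

instance : CompleteSpace (SobolevPair Ω p) :=
  inferInstanceAs
    (CompleteSpace (WithLp 1 (Lp ℝ p (spaceMeasure Ω) × Lp (Euc N) p (spaceMeasure Ω))))

end SobolevPair

/-- The map `ψ ↦ (ψ, ∇ψ)` from `C_c^∞(Ω)` to `W^{1,p}(Ω)`. -/
def testToSobolev (Ω : Opens (Euc N)) (p : ℝ≥0∞) [Fact (1 ≤ p)] :
    𝓓(Ω, ℝ) →ₗ[ℝ] SobolevPair Ω p where
  toFun ψ := WithLp.toLp 1 ((memLp_test p ψ).toLp ψ, (memLp_gradient p ψ).toLp (gradient ψ))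
  map_add' ψ₁ ψ₂ := by
    refine Eq.trans ?_ (WithLp.toLp_add 1 _ _)
    rw [Prod.mk_add_mk, ← MemLp.toLp_add, ← MemLp.toLp_add]
    congr 2
    exact MemLp.toLp_congr _ _ (by rw [gradient_add_test])
  map_smul' c ψ := by
    refine Eq.trans ?_ (WithLp.toLp_smul 1 c _)
    rw [Prod.smul_mk, ← MemLp.toLp_const_smul, ← MemLp.toLp_const_smul]
    congr 2
    exact MemLp.toLp_congr _ _ (by rw [gradient_smul_test])

/-- `W₀^{1,p}(Ω)` as a subspace: the closure of `C_c^∞(Ω)` in `W^{1,p}(Ω)`, a function `u` being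
recorded together with its weak gradient as the pair `(u, ∇u)`. -/
def sobolevZeroSubmodule (Ω : Opens (Euc N)) (p : ℝ≥0∞) [Fact (1 ≤ p)] :
    Submodule ℝ (SobolevPair Ω p) :=
  (LinearMap.range (testToSobolev Ω p)).topologicalClosure

/-- The Banach space `W₀^{1,p}(Ω)`, with the norm `‖u‖_p + ‖∇u‖_p`. -/
def SobolevZero (Ω : Opens (Euc N)) (p : ℝ≥0∞) [Fact (1 ≤ p)] : Type :=
  sobolevZeroSubmodule Ω p

section SobolevZero

variable (Ω : Opens (Euc N)) (p : ℝ≥0∞) [Fact (1 ≤ p)]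

instance : NormedAddCommGroup (SobolevZero Ω p) :=
  inferInstanceAs (NormedAddCommGroup (sobolevZeroSubmodule Ω p))

instance : NormedSpace ℝ (SobolevZero Ω p) :=
  inferInstanceAs (NormedSpace ℝ (sobolevZeroSubmodule Ω p))

/-- The inclusion of `W₀^{1,p}(Ω)` in `L^p(Ω)`. -/
def SobolevZero.toLp : SobolevZero Ω p →ₗ[ℝ] Lp ℝ p (spaceMeasure Ω) where
  toFun u := WithLp.fst (Subtype.val u)
  map_add' _ _ := rfl
  map_smul' _ _ := rfl

end SobolevZero

/-- A test function on `Ω` as an element of `W₀^{1,p}(Ω)`. -/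
def testInSobolevZero {Ω : Opens (Euc N)} (p : ℝ≥0∞) [Fact (1 ≤ p)] (ψ : 𝓓(Ω, ℝ)) :
    SobolevZero Ω p :=
  ⟨testToSobolev Ω p ψ, Submodule.le_topologicalClosure _ (LinearMap.mem_range_self _ ψ)⟩

/-- `V = W₀^{1,p}(Ω) ∩ L²(Ω)` as a subspace: pairs of an element of `W₀^{1,p}(Ω)` and an element of
`L²(Ω)` that are almost everywhere the same function. -/
def energySubmodule (Ω : Opens (Euc N)) (p : ℝ≥0∞) [Fact (1 ≤ p)] :
    Submodule ℝ (WithLp 1 (SobolevZero Ω p × Lp ℝ 2 (spaceMeasure Ω))) where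
  carrier := {z | SobolevZero.toLp Ω p z.fst =ᵐ[spaceMeasure Ω] z.snd}
  zero_mem' := by
    filter_upwards [Lp.coeFn_zero ℝ p (spaceMeasure Ω), Lp.coeFn_zero ℝ 2 (spaceMeasure Ω)]
      with x h₁ h₂
    exact h₁.trans h₂.symm
  add_mem' {a b} ha hb := by
    filter_upwards [ha, hb, Lp.coeFn_add (SobolevZero.toLp Ω p a.fst) (SobolevZero.toLp Ω p b.fst),
      Lp.coeFn_add a.snd b.snd] with x h₁ h₂ h₃ h₄
    refine h₃.trans (Eq.trans ?_ h₄.symm)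
    simp only [Pi.add_apply, h₁, h₂]
  smul_mem' c a ha := by
    filter_upwards [ha, Lp.coeFn_smul c (SobolevZero.toLp Ω p a.fst),
      Lp.coeFn_smul c a.snd] with x h₁ h₂ h₃
    refine h₂.trans (Eq.trans ?_ h₃.symm)
    simp only [Pi.smul_apply, h₁]

/-- The space `V = W₀^{1,p}(Ω) ∩ L²(Ω)`, with the norm `‖·‖_{W^{1,p}} + ‖·‖_{L²}`. -/
def EnergySpace (Ω : Opens (Euc N)) (p : ℝ≥0∞) [Fact (1 ≤ p)] : Type :=
  energySubmodule Ω p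

section EnergySpace

variable (Ω : Opens (Euc N)) (p : ℝ≥0∞) [Fact (1 ≤ p)]

instance : NormedAddCommGroup (EnergySpace Ω p) :=
  inferInstanceAs (NormedAddCommGroup (energySubmodule Ω p))

instance : NormedSpace ℝ (EnergySpace Ω p) :=
  inferInstanceAs (NormedSpace ℝ (energySubmodule Ω p))

/-- The inclusion of `V` in `L²(Ω)`. -/
def EnergySpace.toL2 : EnergySpace Ω p →ₗ[ℝ] Lp ℝ 2 (spaceMeasure Ω) where
  toFun v := WithLp.snd (Subtype.val (p := (· ∈ energySubmodule Ω p)) v)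
  map_add' _ _ := rfl
  map_smul' _ _ := rfl

end EnergySpace

/-- The function on `Ω` that underlies an element of `V`. -/
def EnergySpace.toFunction {Ω : Opens (Euc N)} {p : ℝ≥0∞} [Fact (1 ≤ p)]
    (v : EnergySpace Ω p) : Euc N → ℝ :=
  EnergySpace.toL2 Ω p v

/-- A test function on `Ω` as an element of `V`. -/
def testInEnergySpace {Ω : Opens (Euc N)} (p : ℝ≥0∞) [Fact (1 ≤ p)] (ψ : 𝓓(Ω, ℝ)) :
    EnergySpace Ω p :=
  ⟨WithLp.toLp 1 (testInSobolevZero p ψ, (memLp_test 2 ψ).toLp ψ),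
    (memLp_test p ψ).coeFn_toLp.trans (memLp_test 2 ψ).coeFn_toLp.symm⟩

/-! ### Test functions on the cylinder -/

/-- The slice `φ(t, ·) ∈ C_c^∞(Ω)` of a test function `φ ∈ C_c^∞(Q)`. -/
def slice {T : ℝ} {Ω : Opens (Euc N)} (φ : 𝓓(cylinder T Ω, ℝ)) (t : ℝ) : 𝓓(Ω, ℝ) where
  toFun x := φ (t, x)
  contDiff' := φ.contDiff.comp (contDiff_prodMk_right t)
  hasCompactSupport' := by
    refine HasCompactSupport.intro (φ.hasCompactSupport.isCompact.image continuous_snd) ?_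
    intro x hx
    by_contra h
    exact hx ⟨(t, x), subset_tsupport _ h, rfl⟩
  tsupport_subset' := by
    intro x hx
    have h : (t, x) ∈ tsupport φ :=
      closure_minimal (t := (fun y : Euc N => (t, y)) ⁻¹' tsupport φ)
        (fun y hy => subset_tsupport φ hy)
        ((isClosed_tsupport φ).preimage (by fun_prop)) hx
    exact (φ.tsupport_subset h).2

/-- The partial derivative `∂φ/∂t` of a test function on `Q`. -/
def timeDeriv {T : ℝ} {Ω : Opens (Euc N)} (φ : 𝓓(cylinder T Ω, ℝ)) (z : ℝ × Euc N) : ℝ :=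
  deriv (fun s => φ (s, z.2)) z.1

/-! ### `L^p(0, T; V)`, `W` and the parabolic capacity -/

/-- The real function `u` on `Q` (up to null sets) belongs to `L^p(0, T; V)`, and `U` is the
corresponding Bochner `L^p` map `t ↦ u(t, ·) ∈ V`. -/
structure IsBochnerCurve (T : ℝ) (Ω : Opens (Euc N)) (p : ℝ≥0∞) [Fact (1 ≤ p)]
    (u : ℝ × Euc N → ℝ) (U : ℝ → EnergySpace Ω p) : Prop where
  aestronglyMeasurable : AEStronglyMeasurable u (cylinderMeasure T Ω)
  memLp : MemLp U p (timeMeasure T)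
  ae_eq : ∀ᵐ t ∂timeMeasure T, (fun x => u (t, x)) =ᵐ[spaceMeasure Ω] (U t).toFunction

/-- `u ∈ L^p(0, T; V)`. -/
def MemBochnerV (T : ℝ) (Ω : Opens (Euc N)) (p : ℝ≥0∞) [Fact (1 ≤ p)]
    (u : ℝ × Euc N → ℝ) : Prop :=
  ∃ U : ℝ → EnergySpace Ω p, IsBochnerCurve T Ω p u U

/-- `u ∈ W`, with `u` given by `U ∈ L^p(0, T; V)` and with distributional time derivative
`u_t = w ∈ L^q(0, T; V')`, where `q` is the conjugate exponent of `p`.  The identity `u_t = w` holds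
in `𝓓'(Q)`, where `w` acts by `φ ↦ ∫₀ᵀ ⟨w(t), φ(t, ·)⟩ dt`. -/
structure IsParabolicFunction (T : ℝ) (Ω : Opens (Euc N)) (p q : ℝ≥0∞) [Fact (1 ≤ p)]
    (u : ℝ × Euc N → ℝ) (U : ℝ → EnergySpace Ω p)
    (w : ℝ → StrongDual ℝ (EnergySpace Ω p)) : Prop where
  curve : IsBochnerCurve T Ω p u U
  memLp_deriv : MemLp w q (timeMeasure T)
  hasDeriv : ∀ φ : 𝓓(cylinder T Ω, ℝ),
    -∫ z, u z * timeDeriv φ z ∂cylinderMeasure T Ω =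
      ∫ t, w t (testInEnergySpace p (slice φ t)) ∂timeMeasure T

/-- The parabolic capacity of an open set `O ⊆ Q`: the infimum of
`‖u‖_W = ‖u‖_{L^p(0,T;V)} + ‖u_t‖_{L^q(0,T;V')}` over the `u ∈ W` with `u ≥ χ_O` almost everywhere
in `Q` (and `∞` if there is none). -/
def openCapacity (T : ℝ) (Ω : Opens (Euc N)) (p q : ℝ≥0∞) [Fact (1 ≤ p)]
    (O : Set (ℝ × Euc N)) : ℝ≥0∞ :=
  ⨅ (u : ℝ × Euc N → ℝ) (U : ℝ → EnergySpace Ω p) (w : ℝ → StrongDual ℝ (EnergySpace Ω p))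
    (_ : IsParabolicFunction T Ω p q u U w)
    (_ : ∀ᵐ z ∂cylinderMeasure T Ω, O.indicator 1 z ≤ u z),
    eLpNorm U p (timeMeasure T) + eLpNorm w q (timeMeasure T)

/-- The parabolic capacity of a Borel set `B ⊆ Q`. -/
def capacity (T : ℝ) (Ω : Opens (Euc N)) (p q : ℝ≥0∞) [Fact (1 ≤ p)]
    (B : Set (ℝ × Euc N)) : ℝ≥0∞ :=
  ⨅ (O : Set (ℝ × Euc N)) (_ : IsOpen O) (_ : O ⊆ cylinder T Ω) (_ : B ⊆ O),
    openCapacity T Ω p q O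

/-- The finite signed Borel measure `μ` is diffuse in `Q`: it vanishes on all Borel subsets of `Q` of
zero parabolic capacity. -/
def IsDiffuse (T : ℝ) (Ω : Opens (Euc N)) (p q : ℝ≥0∞) [Fact (1 ≤ p)]
    (μ : SignedMeasure (ℝ × Euc N)) : Prop :=
  ∀ B : Set (ℝ × Euc N), MeasurableSet B → B ⊆ cylinder T Ω → capacity T Ω p q B = 0 → μ B = 0

/-- `μ = f + g_t + χ` in `𝓓'(Q)`. -/
def IsDecomposition (T : ℝ) (Ω : Opens (Euc N)) (p : ℝ≥0∞) [Fact (1 ≤ p)]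
    (μ : SignedMeasure (ℝ × Euc N)) (f g : ℝ × Euc N → ℝ)
    (χ : ℝ → StrongDual ℝ (SobolevZero Ω p)) : Prop :=
  ∀ φ : 𝓓(cylinder T Ω, ℝ),
    ∫ᵛ z, φ z ∂•μ =
      ∫ z, f z * φ z ∂cylinderMeasure T Ω
        + (-∫ z, g z * timeDeriv φ z ∂cylinderMeasure T Ω)
        + ∫ t, χ t (testInSobolevZero p (slice φ t)) ∂timeMeasure T

end ParabolicCapacity

end

/-! Zero capacity supplies functions `u` in `W` of arbitrarily small norm with `u ≥ 1` near the null
set; turned into test functions, they show that `μ` cannot charge it. If `μ B ≠ 0`, regularity of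
the variation `|μ|` gives a compact `K ⊆ B` with `a = |μ K| > 0`, an open `V ⊆ Q` around `K` with
`|μ|(V \ K) ≤ a / 4`, and a smooth cutoff `ζ` that is 1 on `K` and supported in `V`. Let `v = ρ *
u`, with `u` extended by zero outside `Q`, and let `H` be `Real.smoothTransition`, which is 0 on the
negative axis and 1 beyond 1. Then `φ = ζ H(v)` is a test function with values in `[0, 1]`, equal to
1 on `K` once `ρ` has small support (`one_le_mollify`), so `a ≤ |∫ φ dμ| + a / 4`
(`enorm_signedMeasure_le`).

It remains to prove `|∫ φ dμ| ≤ δ + C ‖u‖_W` with `C` independent of `u` and of `ρ`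
(`IsDecomposition.exists_enorm_integral_le`). The terms with `f`, with `g ζ_t H(v)` and with `χ`
follow from `|H(s)| ≤ L |s|`, Young's inequality, and the commutation of mollification with the weak
space gradient on the support of `ζ`. As `f` is only integrable, it is replaced by a simple function
at the cost `δ`.

The delicate term is `∫ G v_t` with `G = ζ H'(v) g`, since `u_t` is controlled only in a dual space.
The kernel is even, so the mollifier passes to the other factor: `∫ G ∂_t(ρ * u) = -∫ u ∂_t(ρ * G) =
∫ ⟨u_t, ρ * G⟩`. Now `ρ * G` is a genuine test function, bounded and with gradient bounded in `L^p`: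
by the product rule this needs exactly that `g` is bounded with gradient in `L^p`, and that `H'`,
`H''` are bounded (`exists_enorm_integral_timeDeriv_le`). -/

noncomputable section

namespace ParabolicCapacity

set_option linter.unusedSectionVars false

open Filter Topology ContinuousLinearMap

/-! ### Mollification: smoothness and Young's inequality. -/

section Mollify

variable {G : Type*} [NormedAddCommGroup G] [NormedSpace ℝ G] [MeasurableSpace G] [BorelSpace G]
  {F : Type*} [NormedAddCommGroup F] [NormedSpace ℝ F]

/-- The convolution of a kernel `ρ` with the vector-valued measure `f dm`. -/
def mollify (ρ : G → ℝ) (m : Measure G) (f : G → F) (z : G) : F := ∫ y, ρ (z - y) • f y ∂m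

theorem mollify_eq_convolution (ρ : G → ℝ) (m : Measure G) (f : G → F) :
    mollify ρ m f = convolution f ρ (lsmul ℝ ℝ).flip m := rfl

theorem integrable_kernel_smul [CompleteSpace F] {ρ : G → ℝ} {m : Measure G} {f : G → F}
    (hρ : Continuous ρ) (hρc : HasCompactSupport ρ) (hf : LocallyIntegrable f m) (z : G) :
    Integrable (fun y => ρ (z - y) • f y) m :=
  hρc.convolutionExists_right (lsmul ℝ ℝ).flip hf hρ z

theorem continuous_mollify {ρ : G → ℝ} {m : Measure G} {f : G → F}
    (hρ : Continuous ρ) (hρc : HasCompactSupport ρ) (hf : LocallyIntegrable f m) :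
    Continuous (mollify ρ m f) :=
  hρc.continuous_convolution_right (lsmul ℝ ℝ).flip hf hρ

theorem contDiff_mollify {ρ : G → ℝ} {m : Measure G} {f : G → F}
    [CompleteSpace F]
    (hρ : ContDiff ℝ ∞ ρ) (hρc : HasCompactSupport ρ) (hf : LocallyIntegrable f m) :
    ContDiff ℝ ∞ (mollify ρ m f) :=
  hρc.contDiff_convolution_right (lsmul ℝ ℝ).flip hf hρ

/-- Restricting the measure amounts to extending the function by zero, so functions on the cylinder
can be convolved over the whole space. -/
theorem mollify_restrict (ρ : G → ℝ) (m : Measure G) (f : G → F) {S : Set G}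
    (hS : MeasurableSet S) : mollify ρ (m.restrict S) f = mollify ρ m (S.indicator f) := by
  funext z
  rw [mollify, mollify, ← integral_indicator hS]
  refine integral_congr_ae (Eventually.of_forall fun y => ?_)
  by_cases hy : y ∈ S <;> simp [hy]

theorem fderiv_mollify_apply {ρ : G → ℝ} {m : Measure G} [SFinite m] [m.IsAddLeftInvariant]
    {f : G → F} [CompleteSpace F] (hρ : ContDiff ℝ ∞ ρ) (hρc : HasCompactSupport ρ) {S : Set G}
    (hS : MeasurableSet S) (hf : IntegrableOn f S m) (z v : G) :
    fderiv ℝ (mollify ρ (m.restrict S) f) z v =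
      ∫ y, fderiv ℝ ρ (z - y) v • f y ∂m.restrict S := by
  have hf' : LocallyIntegrable (S.indicator f) m :=
    ((integrable_indicator_iff hS).2 hf).locallyIntegrable
  let L : F →L[ℝ] ℝ →L[ℝ] F := (lsmul ℝ ℝ).flip
  have hd := hρc.hasFDerivAt_convolution_right (𝕜 := ℝ) L hf'
    (hρ.of_le (by exact_mod_cast le_top)) z
  have hi : Integrable (fun y => L.precompR G (S.indicator f y) (fderiv ℝ ρ (z - y))) m :=
    (hρc.fderiv ℝ).convolutionExists_right (L.precompR G) hf'
      (hρ.continuous_fderiv (by simp)) z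
  rw [mollify_restrict ρ m f hS, mollify_eq_convolution, hd.fderiv, convolution_def,
    ContinuousLinearMap.integral_apply hi, ← integral_indicator hS]
  refine integral_congr_ae (Eventually.of_forall fun y => ?_)
  by_cases hy : y ∈ S <;> simp [hy, precompR_apply, L]

/-- Young's inequality for the convolution with a kernel of mass at most one. -/
theorem eLpNorm_mollify_le {ρ : G → ℝ} {m m' : Measure G} [SecondCountableTopology G]
    [SFinite m] [SFinite m'] {f : G → F}
    (hf : AEStronglyMeasurable f m) (hρ : Continuous ρ)
    (h₁ : ∀ z, ∫⁻ y, ‖ρ (z - y)‖ₑ ∂m ≤ 1) (h₂ : ∀ y, ∫⁻ z, ‖ρ (z - y)‖ₑ ∂m' ≤ 1)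
    {p : ℝ≥0∞} (hp : 1 ≤ p) (hp' : p ≠ ⊤) :
    eLpNorm (mollify ρ m f) p m' ≤ eLpNorm f p m := by
  have hp0 : p ≠ 0 := (zero_lt_one.trans_le hp).ne'
  have hr : 1 ≤ p.toReal := by
    rw [← ENNReal.toReal_one]; exact ENNReal.toReal_mono hp' hp
  have hr0 : 0 < p.toReal := by linarith
  rw [eLpNorm_eq_lintegral_rpow_enorm_toReal hp0 hp', eLpNorm_eq_lintegral_rpow_enorm_toReal hp0 hp']
  refine ENNReal.rpow_le_rpow ?_ (by positivity)
  have hmeas : Measurable (fun zy : G × G => ‖ρ (zy.1 - zy.2)‖ₑ) := by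
    have : Continuous (fun zy : G × G => ρ (zy.1 - zy.2)) := by fun_prop
    exact this.measurable.enorm
  have key : ∀ z, ‖mollify ρ m f z‖ₑ ^ p.toReal ≤
      ∫⁻ y, ‖ρ (z - y)‖ₑ * ‖f y‖ₑ ^ p.toReal ∂m := by
    intro z
    have hk : Measurable (fun y => ‖ρ (z - y)‖ₑ) := hmeas.comp measurable_prodMk_left
    -- Jensen's inequality for the measure `|ρ(z - y)| dm(y)` of mass at most one, in the form of
    -- monotonicity of `L^r` norms; Tonelli then finishes the bound.
    set ν := m.withDensity (fun y => ‖ρ (z - y)‖ₑ) with hν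
    have hfν : AEStronglyMeasurable f ν := hf.mono_ac (withDensity_absolutelyContinuous _ _)
    have hνu : ν univ ≤ 1 := by
      rw [hν, withDensity_apply _ MeasurableSet.univ, Measure.restrict_univ]; exact h₁ z
    have e1 : ‖mollify ρ m f z‖ₑ ≤ eLpNorm' f 1 ν := by
      refine (enorm_integral_le_lintegral_enorm _).trans (le_of_eq ?_)
      simp only [eLpNorm'_eq_lintegral_enorm, ENNReal.rpow_one, div_one, enorm_smul]
      rw [hν, lintegral_withDensity_eq_lintegral_mul₀ hk.aemeasurable hf.enorm]
      rfl
    have e2 := eLpNorm'_le_eLpNorm'_mul_rpow_measure_univ zero_lt_one hr hfν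
    have e3 : ν univ ^ (1 / 1 - 1 / p.toReal) ≤ 1 := by
      refine ENNReal.rpow_le_one hνu ?_
      rw [div_one, sub_nonneg]
      exact (div_le_one hr0).2 hr
    have e4 : ‖mollify ρ m f z‖ₑ ≤ eLpNorm' f p.toReal ν :=
      e1.trans (e2.trans ((mul_le_mul_right e3 _).trans (by rw [mul_one])))
    calc ‖mollify ρ m f z‖ₑ ^ p.toReal ≤ (eLpNorm' f p.toReal ν) ^ p.toReal := by gcongr
      _ = ∫⁻ y, ‖f y‖ₑ ^ p.toReal ∂ν := by
        rw [eLpNorm'_eq_lintegral_enorm, ← ENNReal.rpow_mul, one_div, inv_mul_cancel₀ hr0.ne',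
          ENNReal.rpow_one]
      _ = _ := by
        rw [hν, lintegral_withDensity_eq_lintegral_mul₀ hk.aemeasurable
          (hf.enorm.pow_const _)]
        rfl
  calc ∫⁻ z, ‖mollify ρ m f z‖ₑ ^ p.toReal ∂m'
      ≤ ∫⁻ z, ∫⁻ y, ‖ρ (z - y)‖ₑ * ‖f y‖ₑ ^ p.toReal ∂m ∂m' := lintegral_mono key
    _ = ∫⁻ y, ∫⁻ z, ‖ρ (z - y)‖ₑ * ‖f y‖ₑ ^ p.toReal ∂m' ∂m := by
      refine lintegral_lintegral_swap ?_
      exact hmeas.aemeasurable.mul (hf.enorm.pow_const _).comp_snd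
    _ ≤ ∫⁻ y, ‖f y‖ₑ ^ p.toReal ∂m := by
      refine lintegral_mono fun y => ?_
      have hk : Measurable (fun z => ‖ρ (z - y)‖ₑ) := hmeas.comp measurable_prodMk_right
      rw [lintegral_mul_const _ hk]
      exact (mul_le_mul_left (h₂ y) _).trans (by rw [one_mul])

end Mollify

/-! ### Joint measurability of curves in `L^p(Ω)`. -/

/-- The value at `x` is the pairing of `V t` with a fixed element of `L^q`, hence a continuous
linear function of `V t`. -/
theorem stronglyMeasurable_mollify_curve {N : ℕ} {Ω : Opens (Euc N)} {F : Type*}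
    [NormedAddCommGroup F] [NormedSpace ℝ F] [CompleteSpace F]
    {p q : ℝ≥0∞} [Fact (1 ≤ p)] [Fact (1 ≤ q)] [ENNReal.HolderConjugate p q]
    {V : ℝ → Lp F p (spaceMeasure Ω)} (hV : StronglyMeasurable V) {k : Euc N → ℝ}
    (hk : Continuous k) (hkc : HasCompactSupport k) (x : Euc N) :
    StronglyMeasurable fun t => mollify k (spaceMeasure Ω) (V t) x := by
  have hm : MemLp (fun y => k (x - y)) q (spaceMeasure Ω) := by
    refine Continuous.memLp_of_hasCompactSupport (by fun_prop) ?_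
    exact hkc.comp_homeomorph (Homeomorph.subLeft x)
  let L : F →L[ℝ] ℝ →L[ℝ] F := (lsmul ℝ ℝ).flip
  have : (fun t => mollify k (spaceMeasure Ω) (V t) x) = fun t =>
      L.lpPairing (spaceMeasure Ω) p q (V t) (hm.toLp _) := by
    funext t
    rw [lpPairing_eq_integral]
    refine integral_congr_ae ?_
    filter_upwards [hm.coeFn_toLp] with y hy
    simp [hy, L]
  rw [this]
  exact ((L.lpPairing (spaceMeasure Ω) p q).flip (hm.toLp _)).continuous.comp_stronglyMeasurable hV

/-- Lebesgue differentiation for the extension of `v` by zero; the bound on `rOut / rIn` keeps the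
kernels comparable to averages over balls. -/
theorem ae_tendsto_mollify {N : ℕ} {Ω : Opens (Euc N)} {F : Type*}
    [NormedAddCommGroup F] [NormedSpace ℝ F] [CompleteSpace F]
    {φ : ℕ → ContDiffBump (0 : Euc N)} (hφ : Tendsto (fun n => (φ n).rOut) atTop (𝓝 0))
    (hφ' : ∀ n, (φ n).rOut ≤ 2 * (φ n).rIn) {p : ℝ≥0∞} (hp : 1 ≤ p) {v : Euc N → F}
    (hv : MemLp v p (spaceMeasure Ω)) :
    ∀ᵐ x ∂spaceMeasure Ω,
      Tendsto (fun n => mollify ((φ n).normed volume) (spaceMeasure Ω) v x) atTop (𝓝 (v x)) := by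
  have hg : LocallyIntegrable ((Ω : Set (Euc N)).indicator v) volume :=
    ((memLp_indicator_iff_restrict Ω.isOpen.measurableSet).2 hv).locallyIntegrable hp
  have hlim := ContDiffBump.ae_convolution_tendsto_right_of_locallyIntegrable (K := 2) hφ
    (Eventually.of_forall hφ') hg
  filter_upwards [ae_restrict_of_ae hlim, ae_restrict_mem Ω.isOpen.measurableSet] with x hx hxΩ
  rw [indicator_of_mem hxΩ] at hx
  refine hx.congr fun n => ?_
  rw [convolution_eq_swap, mollify_restrict _ _ _ Ω.isOpen.measurableSet]
  rfl

/-- A curve in `L^p(Ω)` has a jointly measurable representative. -/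
theorem exists_stronglyMeasurable_uncurry {N : ℕ} {Ω : Opens (Euc N)} {F : Type*}
    [NormedAddCommGroup F] [NormedSpace ℝ F] [CompleteSpace F] [SecondCountableTopology F]
    {p q : ℝ≥0∞} [hp : Fact (1 ≤ p)] [hq : Fact (1 ≤ q)] [ENNReal.HolderConjugate p q]
    {τ : Measure ℝ} [SFinite τ]
    {U : ℝ → Lp F p (spaceMeasure Ω)} (hU : AEStronglyMeasurable U τ) :
    ∃ D : ℝ × Euc N → F, StronglyMeasurable D ∧
      ∀ᵐ t ∂τ, (fun x => D (t, x)) =ᵐ[spaceMeasure Ω] U t := by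
  obtain ⟨φ, hφ, hφ'⟩ : ∃ φ : ℕ → ContDiffBump (0 : Euc N),
      Tendsto (fun n => (φ n).rOut) atTop (𝓝 0) ∧ ∀ n, (φ n).rOut ≤ 2 * (φ n).rIn :=
    ⟨fun n => ⟨1 / (n + 1) / 2, 1 / (n + 1), by positivity, half_lt_self (by positivity)⟩,
      tendsto_one_div_add_atTop_nhds_zero_nat, fun n => le_of_eq (by ring)⟩
  obtain ⟨V, hV, hUV⟩ := hU
  have hcont : ∀ n t, Continuous fun x => mollify ((φ n).normed volume) (spaceMeasure Ω) (V t) x :=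
    fun n t => continuous_mollify (φ n).continuous_normed (φ n).hasCompactSupport_normed
      ((Lp.memLp (V t)).locallyIntegrable hp.out)
  have hmeas : ∀ n x, StronglyMeasurable fun t =>
      mollify ((φ n).normed volume) (spaceMeasure Ω) (V t) x := fun n x =>
    stronglyMeasurable_mollify_curve (q := q) hV (φ n).continuous_normed
      (φ n).hasCompactSupport_normed x
  obtain ⟨h, hh⟩ : ∃ h : ℕ → Euc N → ℝ → F, ∀ n x t,
      h n x t = mollify ((φ n).normed volume) (spaceMeasure Ω) (V t) x := ⟨_, fun _ _ _ => rfl⟩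
  simp only [← hh] at hcont hmeas
  -- Carathéodory functions, continuous in `x` and measurable in `t`, are jointly measurable.
  have hjoint : ∀ n, StronglyMeasurable (fun z : ℝ × Euc N => h n z.2 z.1) := fun n =>
    (stronglyMeasurable_uncurry_of_continuous_of_stronglyMeasurable (hcont n)
      fun x => hmeas n x).comp_measurable measurable_swap
  have hlim : ∀ t, ∀ᵐ x ∂spaceMeasure Ω, Tendsto (fun n => h n x t) atTop (𝓝 (V t x)) := by
    simpa only [hh] using fun t => ae_tendsto_mollify hφ hφ' hp.out (Lp.memLp (V t))
  have hset : MeasurableSet {z : ℝ × Euc N | ∃ c, Tendsto (fun n => h n z.2 z.1) atTop (𝓝 c)} :=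
    StronglyMeasurable.measurableSet_exists_tendsto hjoint
  -- Convergence holds for almost every `x` at each `t`; measurability of the convergence set turns
  -- this into a statement almost everywhere on the product.
  have hex : ∀ᵐ z ∂τ.prod (spaceMeasure Ω), ∃ c, Tendsto (fun n => h n z.2 z.1) atTop (𝓝 c) := by
    refine (Measure.ae_prod_iff_ae_ae hset).2 (Eventually.of_forall fun t => ?_)
    filter_upwards [hlim t] with x hx using ⟨_, hx⟩
  obtain ⟨D, hD, hDlim⟩ := exists_stronglyMeasurable_limit_of_tendsto_ae
    (fun n => (hjoint n).aestronglyMeasurable) hex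
  refine ⟨D, hD, ?_⟩
  filter_upwards [Measure.ae_ae_of_ae_prod hDlim, hUV] with t ht htU
  rw [htU]
  filter_upwards [ht, hlim t] with x hx hx'
  exact tendsto_nhds_unique hx hx'

end ParabolicCapacity

end

noncomputable section

namespace ParabolicCapacity

set_option linter.unusedSectionVars false

/-! ### Norms and weak gradients in `W₀^{1,p}(Ω)` and `V`. -/

section Spaces

variable {N : ℕ} {Ω : Opens (Euc N)} {p : ℝ≥0∞} [Fact (1 ≤ p)]

/-- The weak gradient of an element of `W₀^{1,p}(Ω)`. -/
def SobolevZero.grad (u : SobolevZero Ω p) : Lp (Euc N) p (spaceMeasure Ω) :=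
  WithLp.snd (Subtype.val u)

theorem SobolevZero.norm_eq (u : SobolevZero Ω p) :
    ‖u‖ = ‖SobolevZero.toLp Ω p u‖ + ‖u.grad‖ :=
  WithLp.prod_norm_eq_of_L1 (Subtype.val u :
    WithLp 1 (Lp ℝ p (spaceMeasure Ω) × Lp (Euc N) p (spaceMeasure Ω)))

/-- The inclusion of `V` in `W₀^{1,p}(Ω)`. -/
def EnergySpace.toSobolev (v : EnergySpace Ω p) : SobolevZero Ω p :=
  WithLp.fst (Subtype.val (p := (· ∈ energySubmodule Ω p)) v)

theorem EnergySpace.norm_eq (v : EnergySpace Ω p) :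
    ‖v‖ = ‖v.toSobolev‖ + ‖EnergySpace.toL2 Ω p v‖ :=
  WithLp.prod_norm_eq_of_L1 (Subtype.val (p := (· ∈ energySubmodule Ω p)) v)

theorem EnergySpace.toLp_ae_eq (v : EnergySpace Ω p) :
    SobolevZero.toLp Ω p v.toSobolev =ᵐ[spaceMeasure Ω] v.toFunction :=
  Subtype.property (p := (· ∈ energySubmodule Ω p)) v

theorem EnergySpace.continuous_grad_toSobolev :
    Continuous fun v : EnergySpace Ω p => v.toSobolev.grad := by
  refine (LipschitzWith.of_dist_le_mul (K := 1) fun v w => ?_).continuous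
  rw [NNReal.coe_one, one_mul, dist_eq_norm, dist_eq_norm]
  change ‖(v - w).toSobolev.grad‖ ≤ ‖v - w‖
  rw [EnergySpace.norm_eq, SobolevZero.norm_eq]
  linarith [norm_nonneg (SobolevZero.toLp Ω p (v - w).toSobolev),
    norm_nonneg (EnergySpace.toL2 Ω p (v - w))]

theorem enorm_testInSobolevZero (ψ : 𝓓(Ω, ℝ)) :
    ‖testInSobolevZero p ψ‖ₑ =
      eLpNorm ψ p (spaceMeasure Ω) + eLpNorm (gradient ψ) p (spaceMeasure Ω) := by
  rw [← ofReal_norm, SobolevZero.norm_eq, ENNReal.ofReal_add (norm_nonneg _) (norm_nonneg _),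
    ofReal_norm, ofReal_norm]
  congr 1
  · exact Lp.enorm_toLp (memLp_test p ψ)
  · exact Lp.enorm_toLp (memLp_gradient p ψ)

theorem enorm_testInEnergySpace (ψ : 𝓓(Ω, ℝ)) :
    ‖testInEnergySpace p ψ‖ₑ =
      eLpNorm ψ p (spaceMeasure Ω) + eLpNorm (gradient ψ) p (spaceMeasure Ω)
        + eLpNorm ψ 2 (spaceMeasure Ω) := by
  rw [← ofReal_norm, EnergySpace.norm_eq, ENNReal.ofReal_add (norm_nonneg _) (norm_nonneg _),
    ofReal_norm, ofReal_norm]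
  congr 1
  · exact enorm_testInSobolevZero ψ
  · exact Lp.enorm_toLp (memLp_test 2 ψ)

theorem memLp_fderiv_test {q : ℝ≥0∞} (ψ : 𝓓(Ω, ℝ)) (e : Euc N) :
    MemLp (fun x => fderiv ℝ ψ x e) q (spaceMeasure Ω) := by
  refine Continuous.memLp_of_hasCompactSupport ?_ (ψ.hasCompactSupport.fderiv_apply ℝ e)
  exact (ψ.contDiff.continuous_fderiv (by simp)).clm_apply continuous_const

theorem inner_gradient (f : Euc N → ℝ) (x e : Euc N) :
    inner ℝ e (gradient f x) = fderiv ℝ f x e := by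
  rw [real_inner_comm, gradient, InnerProductSpace.toDual_symm_apply]

theorem integral_test_mul_fderiv (ψ₁ ψ₂ : 𝓓(Ω, ℝ)) (e : Euc N) :
    ∫ x, ψ₁ x * fderiv ℝ ψ₂ x e ∂spaceMeasure Ω =
      -∫ x, fderiv ℝ ψ₁ x e * ψ₂ x ∂spaceMeasure Ω := by
  have hd : ∀ (ψ : 𝓓(Ω, ℝ)), Differentiable ℝ ψ := fun ψ => ψ.contDiff.differentiable (by simp)
  have hc : ∀ (ψ : 𝓓(Ω, ℝ)), Continuous fun x => fderiv ℝ ψ x e := fun ψ =>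
    (ψ.contDiff.continuous_fderiv (by simp)).clm_apply continuous_const
  have h0 : ∀ (ψ : 𝓓(Ω, ℝ)) x, x ∉ (Ω : Set (Euc N)) → ψ x = 0 := fun ψ x hx =>
    image_eq_zero_of_notMem_tsupport fun h => hx (ψ.tsupport_subset h)
  rw [setIntegral_eq_integral_of_forall_compl_eq_zero (fun x hx => by rw [h0 ψ₁ x hx, zero_mul]),
    setIntegral_eq_integral_of_forall_compl_eq_zero (fun x hx => by rw [h0 ψ₂ x hx, mul_zero])]
  refine integral_mul_fderiv_eq_neg_fderiv_mul_of_integrable ?_ ?_ ?_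
    (fun x _ => hd ψ₁ x) (fun x _ => hd ψ₂ x)
  · exact ((hc ψ₁).mul ψ₂.continuous).integrable_of_hasCompactSupport
      (ψ₂.hasCompactSupport.mul_left)
  · exact (ψ₁.continuous.mul (hc ψ₂)).integrable_of_hasCompactSupport
      (ψ₁.hasCompactSupport.mul_right)
  · exact (ψ₁.continuous.mul ψ₂.continuous).integrable_of_hasCompactSupport
      (ψ₁.hasCompactSupport.mul_right)

/-- Both sides are continuous functionals of the pair `(v, ∇v)`, so the identity is a closed
condition; it holds on test functions by integration by parts and passes to their closure. -/
theorem SobolevZero.integral_mul_fderiv {q : ℝ≥0∞} [Fact (1 ≤ q)] [ENNReal.HolderConjugate p q]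
    (v : SobolevZero Ω p) (ψ : 𝓓(Ω, ℝ)) (e : Euc N) :
    ∫ x, SobolevZero.toLp Ω p v x * fderiv ℝ ψ x e ∂spaceMeasure Ω =
      -∫ x, inner ℝ e (v.grad x) * ψ x ∂spaceMeasure Ω := by
  let B₁ : ℝ →L[ℝ] ℝ →L[ℝ] ℝ := ContinuousLinearMap.mul ℝ ℝ
  let B₂ : Euc N →L[ℝ] ℝ →L[ℝ] ℝ := (ContinuousLinearMap.mul ℝ ℝ).comp (innerSL ℝ e)
  let ℓ₁ := (B₁.lpPairing (spaceMeasure Ω) p q).flip ((memLp_fderiv_test ψ e).toLp _)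
  let ℓ₂ := (B₂.lpPairing (spaceMeasure Ω) p q).flip ((memLp_test q ψ).toLp _)
  have h₁ : ∀ f : Lp ℝ p (spaceMeasure Ω), ℓ₁ f = ∫ x, f x * fderiv ℝ ψ x e ∂spaceMeasure Ω := by
    intro f
    refine (B₁.lpPairing_eq_integral f _).trans (integral_congr_ae ?_)
    filter_upwards [(memLp_fderiv_test (q := q) ψ e).coeFn_toLp] with x hx
    simp [hx, B₁]
  have h₂ : ∀ f : Lp (Euc N) p (spaceMeasure Ω),
      ℓ₂ f = ∫ x, inner ℝ e (f x) * ψ x ∂spaceMeasure Ω := by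
    intro f
    refine (B₂.lpPairing_eq_integral f _).trans (integral_congr_ae ?_)
    filter_upwards [(memLp_test q ψ).coeFn_toLp] with x hx
    simp [hx, B₂]
  have hcl : IsClosed {z : WithLp 1 (Lp ℝ p (spaceMeasure Ω) × Lp (Euc N) p (spaceMeasure Ω)) |
      ℓ₁ z.fst = -ℓ₂ z.snd} :=
    isClosed_eq (ℓ₁.continuous.comp (WithLp.continuous_fst 1 _ _))
      (ℓ₂.continuous.comp (WithLp.continuous_snd 1 _ _)).neg
  have hsub := closure_minimal (s := ((LinearMap.range (testToSobolev Ω p) : Submodule ℝ _) : Set (SobolevPair Ω p))) ?_ hcl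
  · have hv : ℓ₁ (SobolevZero.toLp Ω p v) = -ℓ₂ v.grad := hsub v.2
    rwa [h₁, h₂] at hv
  · rintro _ ⟨ψ', rfl⟩
    change ℓ₁ ((memLp_test p ψ').toLp ψ') = -ℓ₂ ((memLp_gradient p ψ').toLp (gradient ψ'))
    rw [h₁, h₂]
    have e₁ := (memLp_test p ψ').coeFn_toLp
    have e₂ := (memLp_gradient p ψ').coeFn_toLp
    refine Eq.trans (integral_congr_ae ?_) ((integral_test_mul_fderiv ψ' ψ e).trans
      (congrArg Neg.neg (integral_congr_ae ?_)))
    · filter_upwards [e₁] with x hx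
      exact congrArg (· * _) hx
    · filter_upwards [e₂] with x hx
      rw [← inner_gradient]
      exact congrArg (fun y => inner ℝ e y * _) hx.symm

end Spaces

/-! ### Functions on the cylinder and their weak space gradient. -/

section Cylinder

variable {N : ℕ} {T : ℝ} {Ω : Opens (Euc N)}

theorem cylinderMeasure_eq_prod (T : ℝ) (Ω : Opens (Euc N)) :
    cylinderMeasure T Ω = (timeMeasure T).prod (spaceMeasure Ω) :=
  (Measure.prod_restrict _ _).symm

/-- The vector field `D` is the weak gradient of `u` in the space variable. -/
def HasWeakGradient (T : ℝ) (Ω : Opens (Euc N)) (u : ℝ × Euc N → ℝ) (D : ℝ × Euc N → Euc N) :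
    Prop :=
  ∀ (ψ : 𝓓(cylinder T Ω, ℝ)) (e : Euc N),
    ∫ z, u z * fderiv ℝ ψ z (0, e) ∂cylinderMeasure T Ω =
      -∫ z, inner ℝ e (D z) * ψ z ∂cylinderMeasure T Ω

theorem fderiv_slice (φ : 𝓓(cylinder T Ω, ℝ)) (t : ℝ) (x e : Euc N) :
    fderiv ℝ (slice φ t) x e = fderiv ℝ φ (t, x) (0, e) := by
  have hφ : DifferentiableAt ℝ φ (t, x) := φ.contDiff.differentiable (by simp) _
  have h : HasFDerivAt (slice φ t) ((fderiv ℝ φ (t, x)).comp (ContinuousLinearMap.inr ℝ ℝ _)) x :=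
    hφ.hasFDerivAt.comp x (hasFDerivAt_prodMk_right t x)
  rw [h.fderiv]
  rfl

theorem timeDeriv_eq_fderiv (φ : 𝓓(cylinder T Ω, ℝ)) (z : ℝ × Euc N) :
    timeDeriv φ z = fderiv ℝ φ z (1, 0) := by
  have hφ : DifferentiableAt ℝ φ z := φ.contDiff.differentiable (by simp) _
  have h : HasFDerivAt (fun s => φ (s, z.2))
      ((fderiv ℝ φ z).comp (ContinuousLinearMap.inl ℝ ℝ _)) z.1 :=
    HasFDerivAt.comp (g := φ) z.1 hφ.hasFDerivAt (hasFDerivAt_prodMk_left z.1 z.2)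
  rw [timeDeriv, h.hasDerivAt.deriv]
  rfl

theorem continuous_fderiv_test (φ : 𝓓(cylinder T Ω, ℝ)) (v : ℝ × Euc N) :
    Continuous fun z => fderiv ℝ φ z v :=
  (φ.contDiff.continuous_fderiv (by simp)).clm_apply continuous_const

theorem memLp_test_cylinder {q : ℝ≥0∞} (φ : 𝓓(cylinder T Ω, ℝ)) :
    MemLp φ q (cylinderMeasure T Ω) :=
  φ.continuous.memLp_of_hasCompactSupport φ.hasCompactSupport

theorem memLp_fderiv_test_cylinder {q : ℝ≥0∞} (φ : 𝓓(cylinder T Ω, ℝ)) (v : ℝ × Euc N) :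
    MemLp (fun z => fderiv ℝ φ z v) q (cylinderMeasure T Ω) :=
  (continuous_fderiv_test φ v).memLp_of_hasCompactSupport (φ.hasCompactSupport.fderiv_apply ℝ v)

theorem eLpNorm_prod_le_of_ae_le {α β F X : Type*} [MeasurableSpace α] [MeasurableSpace β]
    [NormedAddCommGroup F] [NormedAddCommGroup X] {τ : Measure α} {ν : Measure β} [SFinite τ]
    [SFinite ν] {p : ℝ≥0∞} (hp0 : p ≠ 0) (hp : p ≠ ⊤) {h : α × β → F} {U : α → X}
    (hh : AEStronglyMeasurable h (τ.prod ν))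
    (hU : ∀ᵐ t ∂τ, eLpNorm (fun x => h (t, x)) p ν ≤ ‖U t‖ₑ) :
    eLpNorm h p (τ.prod ν) ≤ eLpNorm U p τ := by
  have hr0 : 0 < p.toReal := ENNReal.toReal_pos hp0 hp
  rw [eLpNorm_eq_lintegral_rpow_enorm_toReal hp0 hp, eLpNorm_eq_lintegral_rpow_enorm_toReal hp0 hp,
    lintegral_prod _ (hh.enorm.pow_const _)]
  refine ENNReal.rpow_le_rpow (lintegral_mono_ae ?_) (by positivity)
  filter_upwards [hU] with t ht
  rw [eLpNorm_eq_lintegral_rpow_enorm_toReal hp0 hp] at ht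
  calc _ = ((∫⁻ x, ‖h (t, x)‖ₑ ^ p.toReal ∂ν) ^ (1 / p.toReal)) ^ p.toReal := by
        rw [← ENNReal.rpow_mul, one_div, inv_mul_cancel₀ hr0.ne', ENNReal.rpow_one]
    _ ≤ _ := by gcongr

/-- The gradients of the slices have a jointly measurable representative `D`, and the slicewise
integration by parts is integrated in time. This replaces the Bochner curve by functions on `Q`, to
which mollification in space-time applies. -/
theorem IsBochnerCurve.exists_hasWeakGradient {p q : ℝ≥0∞} [hp1 : Fact (1 ≤ p)] (hp : p ≠ ⊤)
    [ENNReal.HolderConjugate p q] {u : ℝ × Euc N → ℝ} {U : ℝ → EnergySpace Ω p}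
    (h : IsBochnerCurve T Ω p u U) :
    eLpNorm u p (cylinderMeasure T Ω) ≤ eLpNorm U p (timeMeasure T) ∧
    ∃ D : ℝ × Euc N → Euc N, AEStronglyMeasurable D (cylinderMeasure T Ω) ∧
      eLpNorm D p (cylinderMeasure T Ω) ≤ eLpNorm U p (timeMeasure T) ∧
      HasWeakGradient T Ω u D := by
  have hp0 : p ≠ 0 := (zero_lt_one.trans_le hp1.out).ne'
  have : Fact (1 ≤ q) := ⟨ENNReal.HolderConjugate.one_le q p⟩
  have hum : AEStronglyMeasurable u ((timeMeasure T).prod (spaceMeasure Ω)) :=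
    cylinderMeasure_eq_prod T Ω ▸ h.aestronglyMeasurable
  have hu : ∀ᵐ t ∂timeMeasure T, (fun x => u (t, x)) =ᵐ[spaceMeasure Ω]
      SobolevZero.toLp Ω p (U t).toSobolev := by
    filter_upwards [h.ae_eq] with t ht using ht.trans (U t).toLp_ae_eq.symm
  obtain ⟨D, hDm, hD⟩ := exists_stronglyMeasurable_uncurry (q := q)
    (EnergySpace.continuous_grad_toSobolev.comp_aestronglyMeasurable h.memLp.1)
  have hub : eLpNorm u p (cylinderMeasure T Ω) ≤ eLpNorm U p (timeMeasure T) := by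
    rw [cylinderMeasure_eq_prod]
    refine eLpNorm_prod_le_of_ae_le hp0 hp hum ?_
    filter_upwards [hu] with t ht
    rw [eLpNorm_congr_ae ht, ← Lp.enorm_def, enorm_le_iff_norm_le, EnergySpace.norm_eq,
      SobolevZero.norm_eq]
    linarith [norm_nonneg (U t).toSobolev.grad, norm_nonneg (EnergySpace.toL2 Ω p (U t))]
  have hDb : eLpNorm D p (cylinderMeasure T Ω) ≤ eLpNorm U p (timeMeasure T) := by
    rw [cylinderMeasure_eq_prod]
    refine eLpNorm_prod_le_of_ae_le hp0 hp hDm.aestronglyMeasurable ?_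
    filter_upwards [hD] with t ht
    rw [eLpNorm_congr_ae ht, ← Lp.enorm_def, enorm_le_iff_norm_le, EnergySpace.norm_eq,
      SobolevZero.norm_eq]
    linarith [norm_nonneg (SobolevZero.toLp Ω p (U t).toSobolev),
      norm_nonneg (EnergySpace.toL2 Ω p (U t))]
  refine ⟨hub, D, hDm.aestronglyMeasurable, hDb, fun ψ e => ?_⟩
  have huL : MemLp u p (cylinderMeasure T Ω) :=
    ⟨h.aestronglyMeasurable, hub.trans_lt h.memLp.2⟩
  have hDL : MemLp (fun z => inner ℝ e (D z)) p (cylinderMeasure T Ω) :=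
    MemLp.const_inner e ⟨hDm.aestronglyMeasurable, hDb.trans_lt h.memLp.2⟩
  have i₁ : Integrable (fun z => u z * fderiv ℝ ψ z (0, e)) (cylinderMeasure T Ω) :=
    huL.integrable_mul (q := q) (memLp_fderiv_test_cylinder ψ (0, e))
  have i₂ : Integrable (fun z => inner ℝ e (D z) * ψ z) (cylinderMeasure T Ω) :=
    hDL.integrable_mul (q := q) (memLp_test_cylinder ψ)
  rw [cylinderMeasure_eq_prod] at i₁ i₂ ⊢
  rw [integral_prod _ i₁, integral_prod _ i₂, ← integral_neg]
  refine integral_congr_ae ?_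
  filter_upwards [hu, hD] with t htu htD
  have hv := (U t).toSobolev.integral_mul_fderiv (q := q) (slice ψ t) e
  refine Eq.trans (integral_congr_ae ?_) (hv.trans (congrArg Neg.neg (integral_congr_ae ?_)))
  · filter_upwards [htu] with x hx
    rw [fderiv_slice, ← hx]
  · filter_upwards [htD] with x hx
    rw [← hx]
    rfl

end Cylinder

end ParabolicCapacity

end

noncomputable section

namespace ParabolicCapacity

set_option linter.unusedSectionVars false

open Filter Topology

variable {N : ℕ} {T : ℝ} {Ω : Opens (Euc N)}

/-! ### Calculus of the space gradient. -/

instance : (volume : Measure (ℝ × Euc N)).IsAddHaarMeasure :=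
  inferInstanceAs ((volume : Measure ℝ).prod (volume : Measure (Euc N))).IsAddHaarMeasure

/-- The gradient in the space variable. -/
def spaceGradient (φ : ℝ × Euc N → ℝ) (z : ℝ × Euc N) : Euc N :=
  (InnerProductSpace.toDual ℝ (Euc N)).symm
    ((fderiv ℝ φ z).comp (ContinuousLinearMap.inr ℝ ℝ (Euc N)))

theorem inner_spaceGradient (φ : ℝ × Euc N → ℝ) (z : ℝ × Euc N) (e : Euc N) :
    inner ℝ e (spaceGradient φ z) = fderiv ℝ φ z (0, e) := by
  rw [real_inner_comm, spaceGradient, InnerProductSpace.toDual_symm_apply]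
  rfl

theorem continuous_spaceGradient {φ : ℝ × Euc N → ℝ} (hφ : ContDiff ℝ ∞ φ) :
    Continuous (spaceGradient φ) :=
  (InnerProductSpace.toDual ℝ (Euc N)).symm.continuous.comp
    ((hφ.continuous_fderiv (by simp)).clm_comp continuous_const)

theorem gradient_slice (φ : 𝓓(cylinder T Ω, ℝ)) (t : ℝ) (x : Euc N) :
    gradient (slice φ t) x = spaceGradient φ (t, x) := by
  refine ext_inner_left ℝ fun e => ?_
  rw [inner_gradient, fderiv_slice, inner_spaceGradient]

theorem spaceGradient_mul {a b : ℝ × Euc N → ℝ} (ha : ContDiff ℝ ∞ a) (hb : ContDiff ℝ ∞ b)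
    (z : ℝ × Euc N) :
    spaceGradient (fun y => a y * b y) z = a z • spaceGradient b z + b z • spaceGradient a z := by
  have ha' : DifferentiableAt ℝ a z := ha.differentiable (by simp) z
  have hb' : DifferentiableAt ℝ b z := hb.differentiable (by simp) z
  refine ext_inner_left ℝ fun e => ?_
  rw [inner_add_right, inner_smul_right, inner_smul_right, inner_spaceGradient,
    inner_spaceGradient, inner_spaceGradient, fderiv_fun_mul ha' hb']
  rfl

theorem fderiv_comp_real {h : ℝ → ℝ} {a : ℝ × Euc N → ℝ} (hh : ContDiff ℝ ∞ h)
    (ha : ContDiff ℝ ∞ a) (z v : ℝ × Euc N) :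
    fderiv ℝ (fun y => h (a y)) z v = deriv h (a z) * fderiv ℝ a z v := by
  have ha' : DifferentiableAt ℝ a z := ha.differentiable (by simp) z
  have hh' : DifferentiableAt ℝ h (a z) := hh.differentiable (by simp) _
  have h' : HasFDerivAt (fun y => h (a y)) (deriv h (a z) • fderiv ℝ a z) z :=
    hh'.hasDerivAt.comp_hasFDerivAt z ha'.hasFDerivAt
  rw [h'.fderiv]
  rfl

theorem spaceGradient_comp {h : ℝ → ℝ} {a : ℝ × Euc N → ℝ} (hh : ContDiff ℝ ∞ h)
    (ha : ContDiff ℝ ∞ a) (z : ℝ × Euc N) :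
    spaceGradient (fun y => h (a y)) z = deriv h (a z) • spaceGradient a z := by
  refine ext_inner_left ℝ fun e => ?_
  rw [inner_smul_right, inner_spaceGradient, inner_spaceGradient, fderiv_comp_real hh ha]

/-! ### Bounds for the duality pairings. -/

section Pairing

theorem measurable_eLpNorm_slice {F : Type*} [NormedAddCommGroup F] {p : ℝ≥0∞} (hp0 : p ≠ 0)
    (hp : p ≠ ⊤) {h : ℝ × Euc N → F} (hh : Continuous h) :
    Measurable fun t => eLpNorm (fun x => h (t, x)) p (spaceMeasure Ω) := by
  have hm : Measurable fun z => ‖h z‖ₑ ^ p.toReal :=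
    (continuous_enorm.comp hh).measurable.pow_const _
  simp only [eLpNorm_eq_lintegral_rpow_enorm_toReal hp0 hp]
  exact (Measurable.lintegral_prod_right' hm).pow_const _

theorem aemeasurable_enorm_mul_eLpNorm_slice (Ω : Opens (Euc N)) {Y F : Type*}
    [NormedAddCommGroup Y] [NormedAddCommGroup F] {p : ℝ≥0∞} (hp0 : p ≠ 0) (hp : p ≠ ⊤) {w : ℝ → Y}
    (hw : AEStronglyMeasurable w (timeMeasure T)) {h : ℝ × Euc N → F} (hh : Continuous h) :
    AEMeasurable (fun t => ‖w t‖ₑ * eLpNorm (fun x => h (t, x)) p (spaceMeasure Ω))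
      (timeMeasure T) :=
  hw.enorm.mul (measurable_eLpNorm_slice hp0 hp hh).aemeasurable

/-- Hölder's inequality in time; by Tonelli the `L^p` norm in time of the slice norms is the norm on
`Q`. -/
theorem lintegral_enorm_mul_eLpNorm_slice_le {Y F : Type*} [NormedAddCommGroup Y]
    [NormedAddCommGroup F] {p q : ℝ≥0∞} (hp1 : 1 < p) (hp : p ≠ ⊤)
    (hpq : ENNReal.HolderConjugate p q) {w : ℝ → Y} (hw : AEStronglyMeasurable w (timeMeasure T))
    {h : ℝ × Euc N → F} (hh : Continuous h) :
    ∫⁻ t, ‖w t‖ₑ * eLpNorm (fun x => h (t, x)) p (spaceMeasure Ω) ∂timeMeasure T ≤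
      eLpNorm w q (timeMeasure T) * eLpNorm h p (cylinderMeasure T Ω) := by
  have hp0 : p ≠ 0 := (zero_lt_one.trans hp1).ne'
  have hp1' : 1 < p.toReal := by
    rw [← ENNReal.toReal_one]; exact (ENNReal.toReal_lt_toReal ENNReal.one_ne_top hp).2 hp1
  have hr : p.toReal.HolderConjugate q.toReal := ENNReal.HolderConjugate.toReal hp1'
  have hq0 : q ≠ 0 := ENNReal.HolderConjugate.ne_zero q p
  have hq : q ≠ ⊤ := ((ENNReal.HolderConjugate.lt_top_iff_one_lt q p).2 hp1).ne
  have hm : Measurable fun z => ‖h z‖ₑ ^ p.toReal :=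
    (continuous_enorm.comp hh).measurable.pow_const _
  have hs := measurable_eLpNorm_slice (Ω := Ω) hp0 hp hh
  refine (ENNReal.lintegral_mul_le_Lp_mul_Lq _ hr.symm hw.enorm hs.aemeasurable).trans ?_
  rw [cylinderMeasure_eq_prod, eLpNorm_eq_lintegral_rpow_enorm_toReal hq0 hq,
    eLpNorm_eq_lintegral_rpow_enorm_toReal hp0 hp, lintegral_prod _ hm.aemeasurable]
  refine mul_le_mul_right (le_of_eq ?_) _
  congr 1
  refine lintegral_congr fun t => ?_
  rw [eLpNorm_eq_lintegral_rpow_enorm_toReal hp0 hp, ← ENNReal.rpow_mul, one_div,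
    inv_mul_cancel₀ hr.pos.ne', ENNReal.rpow_one]

theorem enorm_integral_dual_le {X : Type*} [NormedAddCommGroup X] [NormedSpace ℝ X]
    (τ : Measure ℝ) (w : ℝ → StrongDual ℝ X) (v : ℝ → X) :
    ‖∫ t, w t (v t) ∂τ‖ₑ ≤ ∫⁻ t, ‖w t‖ₑ * ‖v t‖ₑ ∂τ :=
  (enorm_integral_le_lintegral_enorm _).trans
    (lintegral_mono fun t => (w t).le_opENorm (v t))

theorem enorm_integral_sobolevZero_le {p q : ℝ≥0∞} [Fact (1 ≤ p)] (hp1 : 1 < p) (hp : p ≠ ⊤)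
    (hpq : ENNReal.HolderConjugate p q) {χ : ℝ → StrongDual ℝ (SobolevZero Ω p)}
    (hχ : AEStronglyMeasurable χ (timeMeasure T)) (φ : 𝓓(cylinder T Ω, ℝ)) :
    ‖∫ t, χ t (testInSobolevZero p (slice φ t)) ∂timeMeasure T‖ₑ ≤
      eLpNorm χ q (timeMeasure T) *
        (eLpNorm φ p (cylinderMeasure T Ω) + eLpNorm (spaceGradient φ) p (cylinderMeasure T Ω)) := by
  refine (enorm_integral_dual_le _ _ _).trans ?_
  have h₁ := lintegral_enorm_mul_eLpNorm_slice_le (Ω := Ω) hp1 hp hpq hχ φ.continuous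
  have h₂ := lintegral_enorm_mul_eLpNorm_slice_le (Ω := Ω) hp1 hp hpq hχ
    (continuous_spaceGradient φ.contDiff)
  have e : ∀ t, ‖testInSobolevZero p (slice φ t)‖ₑ =
      eLpNorm (fun x => φ (t, x)) p (spaceMeasure Ω) +
        eLpNorm (fun x => spaceGradient φ (t, x)) p (spaceMeasure Ω) := by
    intro t
    rw [enorm_testInSobolevZero, funext (gradient_slice φ t)]
    rfl
  simp only [e, mul_add]
  rw [lintegral_add_left' (aemeasurable_enorm_mul_eLpNorm_slice Ω (zero_lt_one.trans hp1).ne' hp hχ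
    φ.continuous)]
  exact add_le_add h₁ h₂

/-- The norm of `V` contains an `L²` part that the `L^p` norms need not control. The sup bound `M`
takes care of it: each slice has `L²` norm at most `|Ω|^{1/2} M`, and `w` is integrable in time
because the interval is finite. -/
theorem exists_enorm_integral_energySpace_le {p q : ℝ≥0∞} [Fact (1 ≤ p)] (hp1 : 1 < p)
    (hp : p ≠ ⊤) (hpq : ENNReal.HolderConjugate p q) [IsFiniteMeasure (spaceMeasure Ω)] :
    ∃ C : ℝ≥0∞, C ≠ ⊤ ∧ ∀ (w : ℝ → StrongDual ℝ (EnergySpace Ω p)) (φ : 𝓓(cylinder T Ω, ℝ)) (M : ℝ),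
      AEStronglyMeasurable w (timeMeasure T) → (∀ z, ‖φ z‖ ≤ M) →
      ‖∫ t, w t (testInEnergySpace p (slice φ t)) ∂timeMeasure T‖ₑ ≤
        eLpNorm w q (timeMeasure T) * (eLpNorm φ p (cylinderMeasure T Ω) +
          eLpNorm (spaceGradient φ) p (cylinderMeasure T Ω) + C * ENNReal.ofReal M) := by
  have hp0 : p ≠ 0 := (zero_lt_one.trans hp1).ne'
  have hq1 : 1 ≤ q := ENNReal.HolderConjugate.one_le q p
  have hq : q ≠ ⊤ := ((ENNReal.HolderConjugate.lt_top_iff_one_lt q p).2 hp1).ne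
  have hq' : 1 ≤ q.toReal := by
    rw [← ENNReal.toReal_one]; exact ENNReal.toReal_mono hq hq1
  -- `c₁` is the cost of passing from `L^q` to `L¹` in time, `c₂` that of passing from the sup norm
  -- to `L²` in space.
  set c₁ : ℝ≥0∞ := (timeMeasure T) univ ^ (1 / (1 : ℝ≥0∞).toReal - 1 / q.toReal) with hc₁
  set c₂ : ℝ≥0∞ := (spaceMeasure Ω) univ ^ ((2 : ℝ≥0∞).toReal)⁻¹ with hc₂
  refine ⟨c₁ * c₂, ENNReal.mul_ne_top ?_ ?_, fun w φ M hw hM => ?_⟩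
  · refine ENNReal.rpow_ne_top_of_nonneg ?_ (measure_ne_top _ _)
    rw [ENNReal.toReal_one, div_one, sub_nonneg]
    exact (div_le_one (by linarith)).2 hq'
  · exact ENNReal.rpow_ne_top_of_nonneg (by positivity) (measure_ne_top _ _)
  refine (enorm_integral_dual_le _ _ _).trans ?_
  have h₁ := lintegral_enorm_mul_eLpNorm_slice_le (Ω := Ω) hp1 hp hpq hw φ.continuous
  have h₂ := lintegral_enorm_mul_eLpNorm_slice_le (Ω := Ω) hp1 hp hpq hw
    (continuous_spaceGradient φ.contDiff)
  have h₃ : ∫⁻ t, ‖w t‖ₑ * (c₂ * ENNReal.ofReal M) ∂timeMeasure T ≤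
      eLpNorm w q (timeMeasure T) * (c₁ * c₂ * ENNReal.ofReal M) := by
    rw [lintegral_mul_const'' _ hw.enorm, ← eLpNorm_one_eq_lintegral_enorm, mul_assoc c₁,
      ← mul_assoc (eLpNorm w q _)]
    gcongr
    exact eLpNorm_le_eLpNorm_mul_rpow_measure_univ hq1 hw
  have e : ∀ t, ‖testInEnergySpace p (slice φ t)‖ₑ ≤
      eLpNorm (fun x => φ (t, x)) p (spaceMeasure Ω) +
        eLpNorm (fun x => spaceGradient φ (t, x)) p (spaceMeasure Ω) + c₂ * ENNReal.ofReal M := by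
    intro t
    rw [enorm_testInEnergySpace, funext (gradient_slice φ t)]
    gcongr
    · exact le_rfl
    · exact eLpNorm_le_of_ae_bound (Eventually.of_forall fun x => hM (t, x))
  refine (lintegral_mono fun t => mul_le_mul_right (e t) _).trans ?_
  simp only [mul_add]
  rw [lintegral_add_right' _ (hw.enorm.mul_const _),
    lintegral_add_left' (aemeasurable_enorm_mul_eLpNorm_slice Ω hp0 hp hw φ.continuous)]
  exact add_le_add (add_le_add h₁ h₂) h₃

end Pairing

/-- The smooth transition function is Lipschitz, with bounded first and second derivatives. -/
theorem smoothTransition_bounds : ∃ L : ℝ, 0 ≤ L ∧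
    (∀ s, |Real.smoothTransition s| ≤ L * |s|) ∧
    (∀ s, |deriv Real.smoothTransition s| ≤ L) ∧
    ∀ s, |deriv (deriv Real.smoothTransition) s| ≤ L := by
  have hH : ContDiff ℝ ∞ Real.smoothTransition := Real.smoothTransition.contDiff
  have hH' : ContDiff ℝ ∞ (deriv Real.smoothTransition) := (contDiff_infty_iff_deriv.1 hH).2
  have hs : HasCompactSupport (deriv Real.smoothTransition) := by
    refine HasCompactSupport.intro (isCompact_Icc (a := 0) (b := 1)) fun x hx => ?_
    rw [mem_Icc, not_and_or, not_le, not_le] at hx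
    rcases hx with hx | hx
    · have : Real.smoothTransition =ᶠ[𝓝 x] fun _ => 0 := by
        filter_upwards [Iio_mem_nhds hx] with y hy
        exact Real.smoothTransition.zero_of_nonpos (le_of_lt hy)
      rw [this.deriv_eq, deriv_const]
    · have : Real.smoothTransition =ᶠ[𝓝 x] fun _ => 1 := by
        filter_upwards [Ioi_mem_nhds hx] with y hy
        exact Real.smoothTransition.one_of_one_le (le_of_lt hy)
      rw [this.deriv_eq, deriv_const]
  obtain ⟨C₁, hC₁⟩ := hs.exists_bound_of_continuous hH'.continuous
  obtain ⟨C₂, hC₂⟩ := hs.deriv.exists_bound_of_continuous (hH'.continuous_deriv (by simp))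
  refine ⟨max C₁ C₂, ((norm_nonneg _).trans (hC₁ 0)).trans (le_max_left _ _), fun s => ?_,
    fun s => (hC₁ s).trans (le_max_left _ _), fun s => (hC₂ s).trans (le_max_right _ _)⟩
  -- Mean value inequality from the base point 0, where the transition function vanishes.
  have := Convex.norm_image_sub_le_of_norm_deriv_le (f := Real.smoothTransition) (C := max C₁ C₂)
    (s := univ) (x := 0) (y := s) (fun x _ => hH.differentiable (by simp) x)
    (fun x _ => (hC₁ x).trans (le_max_left _ _)) convex_univ trivial trivial
  simpa using this

/-! ### Mollification with a normalized bump on the cylinder. -/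

section Kernel

variable (b : ContDiffBump (0 : ℝ × Euc N))

theorem lintegral_enorm_normed_sub (z : ℝ × Euc N) :
    ∫⁻ y, ‖b.normed volume (z - y)‖ₑ = 1 := by
  rw [lintegral_sub_left_eq_self (fun y => ‖b.normed volume y‖ₑ) z]
  have h := ofReal_integral_eq_lintegral_ofReal (b.integrable_normed (μ := volume))
    (Eventually.of_forall b.nonneg_normed)
  rw [b.integral_normed, ENNReal.ofReal_one] at h
  rw [h]
  exact lintegral_congr fun y => Real.enorm_of_nonneg (b.nonneg_normed y)

theorem lintegral_enorm_normed_sub' (y : ℝ × Euc N) :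
    ∫⁻ z, ‖b.normed volume (z - y)‖ₑ = 1 := by
  rw [← lintegral_enorm_normed_sub b y]
  refine lintegral_congr fun z => ?_
  rw [← b.normed_neg, neg_sub]

theorem eLpNorm_mollify_cylinder_le {F : Type*} [NormedAddCommGroup F] [NormedSpace ℝ F]
    {f : ℝ × Euc N → F} (hf : AEStronglyMeasurable f (cylinderMeasure T Ω)) {p : ℝ≥0∞}
    (hp : 1 ≤ p) (hp' : p ≠ ⊤) :
    eLpNorm (mollify (b.normed volume) (cylinderMeasure T Ω) f) p (cylinderMeasure T Ω) ≤
      eLpNorm f p (cylinderMeasure T Ω) :=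
  eLpNorm_mollify_le hf b.continuous_normed
    (fun z => (lintegral_mono' Measure.restrict_le_self le_rfl).trans
      (lintegral_enorm_normed_sub b z).le)
    (fun z => (lintegral_mono' Measure.restrict_le_self le_rfl).trans
      (lintegral_enorm_normed_sub' b z).le) hp hp'

theorem norm_mollify_cylinder_le {F : Type*} [NormedAddCommGroup F] [NormedSpace ℝ F]
    {f : ℝ × Euc N → F} {M : ℝ} (hM : 0 ≤ M) (hf : ∀ᵐ z ∂cylinderMeasure T Ω, ‖f z‖ ≤ M)
    (z : ℝ × Euc N) :
    ‖mollify (b.normed volume) (cylinderMeasure T Ω) f z‖ ≤ M := by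
  rw [← ENNReal.ofReal_le_ofReal_iff hM, ofReal_norm]
  calc _ ≤ ∫⁻ y, ‖b.normed volume (z - y) • f y‖ₑ ∂cylinderMeasure T Ω :=
        enorm_integral_le_lintegral_enorm _
    _ ≤ ∫⁻ y, ‖b.normed volume (z - y)‖ₑ * ENNReal.ofReal M ∂cylinderMeasure T Ω := by
        refine lintegral_mono_ae ?_
        filter_upwards [hf] with y hy
        rw [enorm_smul, ← ofReal_norm (f y)]
        gcongr
    _ ≤ ∫⁻ y, ‖b.normed volume (z - y)‖ₑ * ENNReal.ofReal M :=
        lintegral_mono' Measure.restrict_le_self le_rfl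
    _ = ENNReal.ofReal M := by
        rw [lintegral_mul_const' _ _ ENNReal.ofReal_ne_top, lintegral_enorm_normed_sub, one_mul]

/-- The translated kernel `y ↦ ρ (z - y)` as a test function. -/
def kernelTest (z : ℝ × Euc N) (hz : Metric.closedBall z b.rOut ⊆ cylinder T Ω) :
    𝓓(cylinder T Ω, ℝ) where
  toFun y := b.normed volume (z - y)
  contDiff' := b.contDiff_normed.comp (contDiff_const.sub contDiff_id)
  hasCompactSupport' := b.hasCompactSupport_normed.comp_homeomorph (Homeomorph.subLeft z)
  tsupport_subset' := by
    refine (closure_minimal (fun y hy => ?_) Metric.isClosed_closedBall).trans hz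
    have : z - y ∈ Function.support (b.normed volume) := hy
    rw [b.support_normed_eq, mem_ball_zero_iff, ← dist_eq_norm, dist_comm] at this
    exact this.le

theorem fderiv_comp_const_sub {f : ℝ × Euc N → ℝ} (hf : ContDiff ℝ ∞ f) (z y v : ℝ × Euc N) :
    fderiv ℝ (fun y => f (z - y)) y v = -fderiv ℝ f (z - y) v := by
  have hf' : DifferentiableAt ℝ f (z - y) := hf.differentiable (by simp) _
  have h : HasFDerivAt (fun y => f (z - y)) ((fderiv ℝ f (z - y)).comp (-.id ℝ _)) y :=
    hf'.hasFDerivAt.comp y ((hasFDerivAt_id y).const_sub z)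
  rw [h.fderiv]
  simp

/-- The translated kernel is an admissible test function when its ball lies in `Q`, and
differentiating `ρ (z - y)` in `y` instead of `z` costs the sign that integration by parts returns.
Nearer to the boundary the extension by zero may create a jump, so later uses are localized. -/
theorem HasWeakGradient.spaceGradient_mollify {u : ℝ × Euc N → ℝ} {D : ℝ × Euc N → Euc N}
    (h : HasWeakGradient T Ω u D) (hu : Integrable u (cylinderMeasure T Ω))
    (hD : Integrable D (cylinderMeasure T Ω)) {z : ℝ × Euc N}
    (hz : Metric.closedBall z b.rOut ⊆ cylinder T Ω) :
    spaceGradient (mollify (b.normed volume) (cylinderMeasure T Ω) u) z =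
      mollify (b.normed volume) (cylinderMeasure T Ω) D z := by
  refine ext_inner_left ℝ fun e => ?_
  have hm := h (kernelTest b z hz) e
  rw [inner_spaceGradient, fderiv_mollify_apply b.contDiff_normed b.hasCompactSupport_normed
    (cylinder T Ω).isOpen.measurableSet hu, mollify, ← integral_inner]
  · rw [← neg_inj]
    refine Eq.trans ?_ (hm.trans (congrArg Neg.neg (integral_congr_ae (Eventually.of_forall ?_))))
    · rw [← integral_neg]
      refine integral_congr_ae (Eventually.of_forall fun y => ?_)
      change _ = u y * fderiv ℝ (fun y => b.normed volume (z - y)) y (0, e)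
      rw [fderiv_comp_const_sub b.contDiff_normed]
      simp only [smul_eq_mul]
      ring
    · intro y
      change inner ℝ e (D y) * b.normed volume (z - y) = _
      simp only [inner_smul_right]
      ring
  · exact integrable_kernel_smul b.continuous_normed b.hasCompactSupport_normed
      hD.locallyIntegrable z

/-- The kernel is even, so its derivative is odd, and Fubini swaps the roles of `u` and `G`. No weak
derivative of either function is needed. -/
theorem integral_mul_fderiv_mollify {u G : ℝ × Euc N → ℝ}
    (hu : Integrable u (cylinderMeasure T Ω)) (hG : Integrable G (cylinderMeasure T Ω))
    (v : ℝ × Euc N) :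
    ∫ z, G z * fderiv ℝ (mollify (b.normed volume) (cylinderMeasure T Ω) u) z v
        ∂cylinderMeasure T Ω =
      -∫ y, u y * fderiv ℝ (mollify (b.normed volume) (cylinderMeasure T Ω) G) y v
        ∂cylinderMeasure T Ω := by
  have hc : Continuous fun x => fderiv ℝ (b.normed volume) x v :=
    ((b.contDiff_normed (n := 1)).continuous_fderiv (by simp)).clm_apply continuous_const
  obtain ⟨C, hC⟩ := (b.hasCompactSupport_normed.fderiv_apply ℝ v).exists_bound_of_continuous hc
  have hodd : ∀ x, fderiv ℝ (b.normed volume) (-x) v = -fderiv ℝ (b.normed volume) x v := by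
    intro x
    have := fderiv_comp_const_sub (b.contDiff_normed (μ := volume)) 0 x v
    simp only [zero_sub, b.normed_neg] at this
    rw [this, neg_neg]
  simp only [fderiv_mollify_apply b.contDiff_normed b.hasCompactSupport_normed
    (cylinder T Ω).isOpen.measurableSet hu, fderiv_mollify_apply b.contDiff_normed
    b.hasCompactSupport_normed (cylinder T Ω).isOpen.measurableSet hG, smul_eq_mul,
    ← integral_const_mul]
  rw [integral_integral_swap, ← integral_neg]
  · refine integral_congr_ae (Eventually.of_forall fun y => ?_)
    simp only
    rw [← integral_neg]
    refine integral_congr_ae (Eventually.of_forall fun z => ?_)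
    simp only
    rw [← neg_sub z y, hodd]
    ring
  · have : Continuous fun zy : (ℝ × Euc N) × (ℝ × Euc N) =>
        fderiv ℝ (b.normed volume) (zy.1 - zy.2) v := hc.comp (continuous_fst.sub continuous_snd)
    refine ((hG.mul_prod hu).bdd_mul this.aestronglyMeasurable
      (Eventually.of_forall fun zy => hC _)).congr (Eventually.of_forall fun zy => ?_)
    simp only [Function.uncurry]
    ring

end Kernel

/-! ### Product rule and smooth cutoffs. -/

/-- If `ψ` is a test function then so is `θ ψ`; the weak identity for `u` is tested with it. -/
theorem HasWeakGradient.mul {u : ℝ × Euc N → ℝ} {D : ℝ × Euc N → Euc N}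
    (h : HasWeakGradient T Ω u D) (hu : Integrable u (cylinderMeasure T Ω))
    (hD : Integrable D (cylinderMeasure T Ω)) {θ : ℝ × Euc N → ℝ} (hθ : ContDiff ℝ ∞ θ) :
    HasWeakGradient T Ω (fun z => θ z * u z) (fun z => θ z • D z + u z • spaceGradient θ z) := by
  intro ψ e
  let ψ' : 𝓓(cylinder T Ω, ℝ) :=
    ⟨fun z => θ z * ψ z, hθ.mul ψ.contDiff, ψ.hasCompactSupport.mul_left,
      (tsupport_mul_subset_right).trans ψ.tsupport_subset⟩
  have hm := h ψ' e
  have hd : ∀ z, fderiv ℝ ψ' z (0, e) =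
      θ z * fderiv ℝ ψ z (0, e) + ψ z * fderiv ℝ θ z (0, e) := by
    intro z
    change fderiv ℝ (fun z => θ z * ψ z) z (0, e) = _
    rw [fderiv_fun_mul (hθ.differentiable (by simp) z)
      (ψ.contDiff.differentiable (by simp) z)]
    rfl
  have hθ' : Continuous fun z => fderiv ℝ θ z (0, e) :=
    (hθ.continuous_fderiv (by simp)).clm_apply continuous_const
  have bdd : ∀ {k : ℝ × Euc N → ℝ}, Continuous k → HasCompactSupport k →
      ∀ {f : ℝ × Euc N → ℝ}, Integrable f (cylinderMeasure T Ω) →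
      Integrable (fun z => f z * k z) (cylinderMeasure T Ω) := by
    intro k hk hkc f hf
    obtain ⟨C, hC⟩ := hkc.exists_bound_of_continuous hk
    exact hf.mul_bdd hk.aestronglyMeasurable (Eventually.of_forall hC)
  have i₁ : Integrable (fun z => u z * (θ z * fderiv ℝ ψ z (0, e))) (cylinderMeasure T Ω) :=
    bdd (hθ.continuous.mul (continuous_fderiv_test ψ _))
      (ψ.hasCompactSupport.fderiv_apply ℝ (0, e)).mul_left hu
  have i₂ : Integrable (fun z => u z * (ψ z * fderiv ℝ θ z (0, e))) (cylinderMeasure T Ω) :=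
    bdd (ψ.continuous.mul hθ') ψ.hasCompactSupport.mul_right hu
  have i₃ : Integrable (fun z => inner ℝ e (D z) * (θ z * ψ z)) (cylinderMeasure T Ω) :=
    bdd (hθ.continuous.mul ψ.continuous) ψ.hasCompactSupport.mul_left (hD.const_inner e)
  simp only [hd, mul_add] at hm
  rw [integral_add i₁ i₂] at hm
  have e₁ : ∫ z, θ z * u z * fderiv ℝ ψ z (0, e) ∂cylinderMeasure T Ω =
      ∫ z, u z * (θ z * fderiv ℝ ψ z (0, e)) ∂cylinderMeasure T Ω :=
    integral_congr_ae (Eventually.of_forall fun z => by simp only; ring)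
  have e₂ : ∫ z, inner ℝ e (θ z • D z + u z • spaceGradient θ z) * ψ z ∂cylinderMeasure T Ω =
      ∫ z, inner ℝ e (D z) * (θ z * ψ z) ∂cylinderMeasure T Ω +
        ∫ z, u z * (ψ z * fderiv ℝ θ z (0, e)) ∂cylinderMeasure T Ω := by
    rw [← integral_add i₃ i₂]
    refine integral_congr_ae (Eventually.of_forall fun z => ?_)
    simp only [inner_add_right, inner_smul_right, inner_spaceGradient]
    ring
  rw [e₁, e₂, neg_add]
  linarith [hm.trans (rfl : _ = -∫ z, inner ℝ e (D z) * (θ z * ψ z) ∂cylinderMeasure T Ω)]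

/-- The product of a test function and a smooth function. -/
def mulTest (ζ : 𝓓(cylinder T Ω, ℝ)) {v : ℝ × Euc N → ℝ} (hv : ContDiff ℝ ∞ v) :
    𝓓(cylinder T Ω, ℝ) :=
  ⟨fun z => ζ z * v z, ζ.contDiff.mul hv, ζ.hasCompactSupport.mul_right,
    (tsupport_mul_subset_left).trans ζ.tsupport_subset⟩

theorem mulTest_apply (ζ : 𝓓(cylinder T Ω, ℝ)) {v : ℝ × Euc N → ℝ} (hv : ContDiff ℝ ∞ v)
    (z : ℝ × Euc N) : mulTest ζ hv z = ζ z * v z := rfl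

theorem tsupport_mulTest_subset (ζ : 𝓓(cylinder T Ω, ℝ)) {v : ℝ × Euc N → ℝ}
    (hv : ContDiff ℝ ∞ v) : tsupport (mulTest ζ hv) ⊆ tsupport ζ := tsupport_mul_subset_left

theorem spaceGradient_eq_zero {φ : ℝ × Euc N → ℝ} {z : ℝ × Euc N} (hz : z ∉ tsupport φ) :
    spaceGradient φ z = 0 := by
  have h : fderiv ℝ φ z = 0 := by
    by_contra h
    exact hz (support_fderiv_subset ℝ h)
  rw [spaceGradient, h, ContinuousLinearMap.zero_comp, map_zero]

/-! ### Mollifying compactly supported functions into test functions. -/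

section MollifyTest

variable (b : ContDiffBump (0 : ℝ × Euc N))

theorem mollify_mul_eq_zero (θ : 𝓓(cylinder T Ω, ℝ)) (g : ℝ × Euc N → ℝ) {z : ℝ × Euc N}
    (hz : z ∉ Metric.cthickening b.rOut (tsupport θ)) :
    mollify (b.normed volume) (cylinderMeasure T Ω) (fun y => θ y * g y) z = 0 := by
  have h0 : ∀ y, b.normed volume (z - y) • (θ y * g y) = 0 := by
    intro y
    by_cases hy : y ∈ tsupport θ
    · have : z - y ∉ Function.support (b.normed volume) := by
        rw [b.support_normed_eq, mem_ball_zero_iff, ← dist_eq_norm]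
        exact fun h => hz (Metric.mem_cthickening_of_dist_le z y _ _ hy h.le)
      rw [Function.notMem_support.1 this, zero_smul]
    · rw [image_eq_zero_of_notMem_tsupport hy, zero_mul, smul_zero]
  simp only [mollify, h0, integral_zero]

/-- The radius `2 ε` pays for two steps: from `K` to a point of its thickening, and from there
across the kernel's ball. -/
theorem closedBall_subset_of_mem_cthickening {K S : Set (ℝ × Euc N)} (hK : IsCompact K) {ε : ℝ}
    (hε : 0 ≤ ε) (h : ∀ z ∈ K, Metric.closedBall z (2 * ε) ⊆ S) {z : ℝ × Euc N}
    (hz : z ∈ Metric.cthickening ε K) : Metric.closedBall z ε ⊆ S := by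
  rw [hK.cthickening_eq_biUnion_closedBall hε, mem_iUnion₂] at hz
  obtain ⟨y, hy, hzy⟩ := hz
  refine (Metric.closedBall_subset_closedBall' ?_).trans (h y hy)
  linarith [Metric.mem_closedBall.1 hzy]

/-- The convolution of a function compactly supported in `Q` with a kernel of small support, as a
test function. -/
def mollifyTest (θ : 𝓓(cylinder T Ω, ℝ))
    (hb : ∀ z ∈ tsupport θ, Metric.closedBall z (2 * b.rOut) ⊆ cylinder T Ω)
    {g : ℝ × Euc N → ℝ} (hg : Integrable (fun y => θ y * g y) (cylinderMeasure T Ω)) :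
    𝓓(cylinder T Ω, ℝ) where
  toFun := mollify (b.normed volume) (cylinderMeasure T Ω) (fun y => θ y * g y)
  contDiff' := contDiff_mollify b.contDiff_normed b.hasCompactSupport_normed hg.locallyIntegrable
  hasCompactSupport' := HasCompactSupport.intro
    (θ.hasCompactSupport.isCompact.cthickening (r := b.rOut)) fun _ => mollify_mul_eq_zero b θ g
  tsupport_subset' := by
    refine (closure_minimal (fun z hz => ?_) Metric.isClosed_cthickening).trans fun z hz =>
      closedBall_subset_of_mem_cthickening θ.hasCompactSupport.isCompact b.rOut_pos.le hb hz
        (Metric.mem_closedBall_self b.rOut_pos.le)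
    by_contra h
    exact hz (mollify_mul_eq_zero b θ g h)

/-- Equality holds on the thickened support, where the kernel's ball lies in `Q`. Elsewhere the left
side is zero, which avoids the commutation formula near the boundary. -/
theorem norm_spaceGradient_mollifyTest_le (θ : 𝓓(cylinder T Ω, ℝ))
    (hb : ∀ z ∈ tsupport θ, Metric.closedBall z (2 * b.rOut) ⊆ cylinder T Ω)
    {g : ℝ × Euc N → ℝ} {D : ℝ × Euc N → Euc N} (h : HasWeakGradient T Ω g D)
    (hg : Integrable g (cylinderMeasure T Ω)) (hD : Integrable D (cylinderMeasure T Ω))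
    (hθg : Integrable (fun y => θ y * g y) (cylinderMeasure T Ω))
    (hF : Integrable (fun y => θ y • D y + g y • spaceGradient θ y) (cylinderMeasure T Ω))
    (z : ℝ × Euc N) :
    ‖spaceGradient (mollifyTest b θ hb hθg) z‖ ≤
      ‖mollify (b.normed volume) (cylinderMeasure T Ω)
        (fun y => θ y • D y + g y • spaceGradient θ y) z‖ := by
  by_cases hz : z ∈ Metric.cthickening b.rOut (tsupport θ)
  · exact (congrArg norm ((h.mul hg hD θ.contDiff).spaceGradient_mollify b hθg hF
      (closedBall_subset_of_mem_cthickening θ.hasCompactSupport.isCompact b.rOut_pos.le hb hz))).le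
  · have hsub : tsupport (mollifyTest b θ hb hθg) ⊆ Metric.cthickening b.rOut (tsupport θ) := by
      refine closure_minimal (fun y hy => ?_) Metric.isClosed_cthickening
      by_contra h
      exact hy (mollify_mul_eq_zero b θ g h)
    rw [spaceGradient_eq_zero fun h => hz (hsub h), norm_zero]
    exact norm_nonneg _

end MollifyTest

/-! ### The term containing the time derivative of `u`. -/

section Estimates

variable {p q : ℝ≥0∞} [Fact (1 ≤ p)]

local notation "H" => Real.smoothTransition

theorem contDiff_smoothTransition : ContDiff ℝ ∞ H := Real.smoothTransition.contDiff

theorem contDiff_deriv_smoothTransition : ContDiff ℝ ∞ (deriv H) :=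
  (contDiff_infty_iff_deriv.1 contDiff_smoothTransition).2

theorem exists_bound_test (ζ : 𝓓(cylinder T Ω, ℝ)) :
    ∃ Z : ℝ, 0 ≤ Z ∧ ∀ z, ‖spaceGradient ζ z‖ ≤ Z := by
  have hs : HasCompactSupport (spaceGradient ζ) := ζ.hasCompactSupport.mono' fun z hz => by
    by_contra h
    exact hz (spaceGradient_eq_zero h)
  obtain ⟨Z, hZ⟩ := hs.exists_bound_of_continuous (continuous_spaceGradient ζ.contDiff)
  exact ⟨Z, (norm_nonneg _).trans (hZ 0), hZ⟩

variable (b : ContDiffBump (0 : ℝ × Euc N))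

theorem contDiff_mollify_cylinder {u : ℝ × Euc N → ℝ} (hu : Integrable u (cylinderMeasure T Ω)) :
    ContDiff ℝ ∞ (mollify (b.normed volume) (cylinderMeasure T Ω) u) :=
  contDiff_mollify b.contDiff_normed b.hasCompactSupport_normed hu.locallyIntegrable

theorem enorm_integral_mul_le {α : Type*} [MeasurableSpace α] {m : Measure α} {p q : ℝ≥0∞}
    (hpq : ENNReal.HolderConjugate p q) {k v : α → ℝ} (hk : AEStronglyMeasurable k m)
    (hv : AEStronglyMeasurable v m) :
    ‖∫ z, k z * v z ∂m‖ₑ ≤ eLpNorm k p m * eLpNorm v q m := by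
  have h := eLpNorm_smul_le_mul_eLpNorm (p := p) (q := q) (r := 1) hv hk
  rw [eLpNorm_one_eq_lintegral_enorm] at h
  exact (enorm_integral_le_lintegral_enorm _).trans h

/-- Since `H` grows at most linearly from `H(0) = 0`, Hölder's inequality makes the integral small
with `u`, uniformly in the mollifier. -/
theorem enorm_integral_mul_smoothTransition_le {L : ℝ} (hL : ∀ s, |H s| ≤ L * |s|)
    (hp1 : 1 ≤ p) (hp : p ≠ ⊤) (hpq : ENNReal.HolderConjugate p q)
    {u k : ℝ × Euc N → ℝ} (hu : AEStronglyMeasurable u (cylinderMeasure T Ω))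
    (hui : Integrable u (cylinderMeasure T Ω))
    (hk : AEStronglyMeasurable k (cylinderMeasure T Ω)) :
    ‖∫ z, k z * H (mollify (b.normed volume) (cylinderMeasure T Ω) u z) ∂cylinderMeasure T Ω‖ₑ ≤
      ENNReal.ofReal L * eLpNorm k q (cylinderMeasure T Ω) *
        eLpNorm u p (cylinderMeasure T Ω) := by
  have hvc := (contDiff_mollify_cylinder b hui).continuous
  have hve := eLpNorm_mollify_cylinder_le b hu hp1 hp
  generalize mollify (b.normed volume) (cylinderMeasure T Ω) u = v at hvc hve ⊢
  have hH : eLpNorm (fun z => H (v z)) p (cylinderMeasure T Ω) ≤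
      ENNReal.ofReal L * eLpNorm v p (cylinderMeasure T Ω) :=
    eLpNorm_le_mul_eLpNorm_of_ae_le_mul (Eventually.of_forall fun z => hL (v z)) p
  have hHm : AEStronglyMeasurable (fun z => H (v z)) (cylinderMeasure T Ω) :=
    (Real.smoothTransition.continuous.comp hvc).aestronglyMeasurable
  refine (enorm_integral_mul_le hpq.symm hk hHm).trans ?_
  rw [mul_comm (ENNReal.ofReal L), mul_assoc]
  exact mul_le_mul_right (hH.trans (mul_le_mul_right hve _)) _

/-- Product and chain rules on the support of `ζ`, where the gradient commutes with the mollifier.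
The outer function `h` is `H` for the test function itself and `H'` for the factor multiplying `g`.
-/
theorem norm_spaceGradient_mulTest_le {L : ℝ} (hL0 : 0 ≤ L) {h : ℝ → ℝ}
    (hh : ContDiff ℝ ∞ h) (hL : ∀ s, |deriv h s| ≤ L)
    {ζ : 𝓓(cylinder T Ω, ℝ)} (hζ : ∀ z, |ζ z| ≤ 1)
    (hb : ∀ z ∈ tsupport ζ, Metric.closedBall z (2 * b.rOut) ⊆ cylinder T Ω)
    {u : ℝ × Euc N → ℝ} {D : ℝ × Euc N → Euc N} (hw : HasWeakGradient T Ω u D)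
    (hu : Integrable u (cylinderMeasure T Ω)) (hD : Integrable D (cylinderMeasure T Ω))
    (z : ℝ × Euc N) :
    ‖spaceGradient (mulTest ζ (hh.comp (contDiff_mollify_cylinder b hu))) z‖ ≤
      L * ‖mollify (b.normed volume) (cylinderMeasure T Ω) D z‖ +
        |h (mollify (b.normed volume) (cylinderMeasure T Ω) u z)| * ‖spaceGradient ζ z‖ := by
  by_cases hz : z ∈ tsupport ζ
  · have e : spaceGradient (mulTest ζ (hh.comp (contDiff_mollify_cylinder b hu))) z = _ :=
      spaceGradient_mul ζ.contDiff (hh.comp (contDiff_mollify_cylinder b hu)) z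
    have e' : spaceGradient (h ∘ mollify (b.normed volume) (cylinderMeasure T Ω) u) z = _ :=
      spaceGradient_comp hh (contDiff_mollify_cylinder b hu) z
    have hball : Metric.closedBall z b.rOut ⊆ cylinder T Ω :=
      (Metric.closedBall_subset_closedBall (by linarith [b.rOut_pos])).trans (hb z hz)
    rw [e, e', hw.spaceGradient_mollify b hu hD hball]
    refine (norm_add_le _ _).trans (add_le_add ?_ (norm_smul_le _ _))
    rw [norm_smul, norm_smul, ← mul_assoc]
    refine mul_le_mul_of_nonneg_right ?_ (norm_nonneg _)
    exact (mul_le_mul (hζ z) (hL _) (abs_nonneg _) zero_le_one).trans_eq (one_mul L)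
  · rw [spaceGradient_eq_zero fun h => hz (tsupport_mulTest_subset _ _ h), norm_zero]
    positivity

theorem eLpNorm_le_of_norm_le_add {α X Y Z : Type*} [MeasurableSpace α] {m : Measure α}
    [NormedAddCommGroup X] [NormedAddCommGroup Y] [NormedAddCommGroup Z] {p : ℝ≥0∞} (hp : 1 ≤ p)
    {f : α → X} {a : α → Y} {c : α → Z} (ha : AEStronglyMeasurable a m)
    (hc : AEStronglyMeasurable c m) {A C : ℝ} (hA : 0 ≤ A) (hC : 0 ≤ C)
    (h : ∀ᵐ z ∂m, ‖f z‖ ≤ A * ‖a z‖ + C * ‖c z‖) :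
    eLpNorm f p m ≤ ENNReal.ofReal A * eLpNorm a p m + ENNReal.ofReal C * eLpNorm c p m := by
  refine (eLpNorm_mono_ae_real h).trans ((eLpNorm_add_le (ha.norm.const_mul A)
    (hc.norm.const_mul C) hp).trans (add_le_add ?_ ?_))
  · exact eLpNorm_le_mul_eLpNorm_of_ae_le_mul
      (Eventually.of_forall fun z => by rw [norm_mul, norm_norm, Real.norm_of_nonneg hA]) p
  · exact eLpNorm_le_mul_eLpNorm_of_ae_le_mul
      (Eventually.of_forall fun z => by rw [norm_mul, norm_norm, Real.norm_of_nonneg hC]) p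

/-- Moving the mollifier off `u` makes the integral a pairing of `w = u_t` with the mollification of
`ζ H'(v) g`. Smallness comes from `w` alone; the other factor need only be bounded. The
normalization of `D` in `L^p` absorbs the `H''(v) ∇v` contribution and lets `C` be chosen before `u`
and `b`. -/
theorem exists_enorm_integral_timeDeriv_le {L M : ℝ} (hL0 : 0 ≤ L) (hM0 : 0 ≤ M)
    (hL' : ∀ s, |deriv H s| ≤ L) (hL'' : ∀ s, |deriv (deriv H) s| ≤ L)
    (hp1 : 1 < p) (hp : p ≠ ⊤) (hpq : ENNReal.HolderConjugate p q)
    [IsFiniteMeasure (spaceMeasure Ω)] [IsFiniteMeasure (cylinderMeasure T Ω)]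
    {ζ : 𝓓(cylinder T Ω, ℝ)} (hζ : ∀ z, |ζ z| ≤ 1)
    {g : ℝ × Euc N → ℝ} {Dg : ℝ × Euc N → Euc N} (hg : MemLp g p (cylinderMeasure T Ω))
    (hDg : MemLp Dg p (cylinderMeasure T Ω)) (hgw : HasWeakGradient T Ω g Dg)
    (hgM : ∀ᵐ z ∂cylinderMeasure T Ω, ‖g z‖ ≤ M) :
    ∃ C : ℝ≥0∞, C ≠ ⊤ ∧ ∀ (b : ContDiffBump (0 : ℝ × Euc N)) (u : ℝ × Euc N → ℝ)
      (D : ℝ × Euc N → Euc N) (U : ℝ → EnergySpace Ω p) (w : ℝ → StrongDual ℝ (EnergySpace Ω p)),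
      (∀ z ∈ tsupport ζ, Metric.closedBall z (2 * b.rOut) ⊆ cylinder T Ω) →
      IsParabolicFunction T Ω p q u U w →
      MemLp u p (cylinderMeasure T Ω) → MemLp D p (cylinderMeasure T Ω) →
      HasWeakGradient T Ω u D → eLpNorm D p (cylinderMeasure T Ω) ≤ 1 →
      ‖∫ z, ζ z * deriv H (mollify (b.normed volume) (cylinderMeasure T Ω) u z) * g z *
        fderiv ℝ (mollify (b.normed volume) (cylinderMeasure T Ω) u) z (1, 0)
          ∂cylinderMeasure T Ω‖ₑ ≤ C * eLpNorm w q (timeMeasure T) := by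
  obtain ⟨C₀, hC₀, hest⟩ := exists_enorm_integral_energySpace_le (T := T) (Ω := Ω) hp1 hp hpq
  have hζm : MemLp (spaceGradient ζ) p (cylinderMeasure T Ω) := by
    refine (continuous_spaceGradient ζ.contDiff).memLp_of_hasCompactSupport
      (ζ.hasCompactSupport.mono' fun z hz => ?_)
    by_contra h
    exact hz (spaceGradient_eq_zero h)
  -- The summands bound, for the mollification `Φ` of `ζ H'(v) g`, its `L^p` norm, the `L^p` norm of
  -- its gradient, and `C₀` times its sup norm.
  refine ⟨ENNReal.ofReal L * eLpNorm g p (cylinderMeasure T Ω) +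
    (ENNReal.ofReal L * eLpNorm Dg p (cylinderMeasure T Ω) + ENNReal.ofReal M *
      (ENNReal.ofReal L * 1 + ENNReal.ofReal L * eLpNorm (spaceGradient ζ) p
        (cylinderMeasure T Ω))) + C₀ * ENNReal.ofReal (L * M), ?_, ?_⟩
  · have := hg.eLpNorm_ne_top
    have := hDg.eLpNorm_ne_top
    have := hζm.eLpNorm_ne_top
    finiteness
  intro b u D U w hb hpar hu hD huw hD1
  have hui := hu.integrable hp1.le
  have hDi := hD.integrable hp1.le
  have hgi := hg.integrable hp1.le
  have hDgi := hDg.integrable hp1.le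
  -- `θ = ζ H'(v)`, the smooth factor of `g`.
  let θ := mulTest ζ (contDiff_deriv_smoothTransition.comp (contDiff_mollify_cylinder b hui))
  have hθL : ∀ z, ‖θ z‖ ≤ L := fun z => by
    rw [mulTest_apply, norm_mul]
    exact (mul_le_mul (hζ z) (hL' _) (abs_nonneg _) zero_le_one).trans_eq (one_mul L)
  have hθb : ∀ z ∈ tsupport θ, Metric.closedBall z (2 * b.rOut) ⊆ cylinder T Ω := fun z hz =>
    hb z (tsupport_mulTest_subset _ _ hz)
  have hGM : ∀ᵐ z ∂cylinderMeasure T Ω, ‖θ z * g z‖ ≤ L * M := by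
    filter_upwards [hgM] with z hz
    rw [norm_mul]
    exact mul_le_mul (hθL z) hz (norm_nonneg _) hL0
  have hGi : Integrable (fun z => θ z * g z) (cylinderMeasure T Ω) :=
    hgi.bdd_mul θ.continuous.aestronglyMeasurable (Eventually.of_forall hθL)
  have hθc := continuous_spaceGradient θ.contDiff
  have hθn : eLpNorm (spaceGradient θ) p (cylinderMeasure T Ω) ≤ ENNReal.ofReal L * 1 +
      ENNReal.ofReal L * eLpNorm (spaceGradient ζ) p (cylinderMeasure T Ω) := by
    refine (eLpNorm_le_of_norm_le_add hp1.le
      (continuous_mollify b.continuous_normed b.hasCompactSupport_normed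
        hDi.locallyIntegrable).aestronglyMeasurable hζm.1 hL0 hL0
      (Eventually.of_forall fun z => (norm_spaceGradient_mulTest_le b hL0
        contDiff_deriv_smoothTransition hL'' hζ hb huw hui hDi z).trans ?_)).trans
      (add_le_add_left (mul_le_mul_right
        ((eLpNorm_mollify_cylinder_le b hD.1 hp1.le hp).trans hD1) _) _)
    exact add_le_add_right (mul_le_mul_of_nonneg_right (hL' _) (norm_nonneg _)) _
  have hFle : ∀ᵐ z ∂cylinderMeasure T Ω, ‖θ z • Dg z + g z • spaceGradient θ z‖ ≤
      L * ‖Dg z‖ + M * ‖spaceGradient θ z‖ := by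
    filter_upwards [hgM] with z hz
    refine (norm_add_le _ _).trans (add_le_add ?_ ?_)
    · rw [norm_smul]; exact mul_le_mul_of_nonneg_right (hθL z) (norm_nonneg _)
    · rw [norm_smul]; exact mul_le_mul_of_nonneg_right hz (norm_nonneg _)
  have hFm : AEStronglyMeasurable (fun z => θ z • Dg z + g z • spaceGradient θ z)
      (cylinderMeasure T Ω) :=
    (θ.continuous.aestronglyMeasurable.smul hDg.1).add (hg.1.smul hθc.aestronglyMeasurable)
  have hFn := eLpNorm_le_of_norm_le_add hp1.le hDg.1 hθc.aestronglyMeasurable hL0 hM0 hFle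
  have hFL : MemLp (fun z => θ z • Dg z + g z • spaceGradient θ z) p (cylinderMeasure T Ω) := by
    refine ⟨hFm, hFn.trans_lt ?_⟩
    have := hDg.eLpNorm_ne_top
    have := hζm.eLpNorm_ne_top
    have h2 : eLpNorm (spaceGradient θ) p (cylinderMeasure T Ω) ≠ ⊤ :=
      (hθn.trans_lt (by finiteness)).ne
    finiteness
  have hFi := hFL.integrable hp1.le
  let Φ := mollifyTest b θ hθb hGi
  have hΦM : ∀ z, ‖Φ z‖ ≤ L * M := fun z =>
    norm_mollify_cylinder_le b (mul_nonneg hL0 hM0) hGM z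
  have hΦp : eLpNorm Φ p (cylinderMeasure T Ω) ≤
      ENNReal.ofReal L * eLpNorm g p (cylinderMeasure T Ω) := by
    refine (eLpNorm_mollify_cylinder_le b hGi.1 hp1.le hp).trans
      (eLpNorm_le_mul_eLpNorm_of_ae_le_mul (Eventually.of_forall fun z => ?_) p)
    rw [norm_mul]
    exact mul_le_mul_of_nonneg_right (hθL z) (norm_nonneg _)
  have hΦg : eLpNorm (spaceGradient Φ) p (cylinderMeasure T Ω) ≤
      ENNReal.ofReal L * eLpNorm Dg p (cylinderMeasure T Ω) + ENNReal.ofReal M *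
      (ENNReal.ofReal L * 1 + ENNReal.ofReal L * eLpNorm (spaceGradient ζ) p
        (cylinderMeasure T Ω)) := by
    refine (eLpNorm_mono fun z => norm_spaceGradient_mollifyTest_le b θ hθb hgw hgi hDgi hGi hFi
      z).trans ((eLpNorm_mollify_cylinder_le b hFm hp1.le hp).trans (hFn.trans ?_))
    gcongr
  -- The two minus signs cancel: one from moving the mollifier, one from the definition of the
  -- distributional derivative of `u`.
  have hid : ∫ z, θ z * g z * fderiv ℝ (mollify (b.normed volume) (cylinderMeasure T Ω) u) z (1, 0)
      ∂cylinderMeasure T Ω = ∫ t, w t (testInEnergySpace p (slice Φ t)) ∂timeMeasure T := by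
    rw [← hpar.hasDeriv Φ]
    simp only [timeDeriv_eq_fderiv]
    exact integral_mul_fderiv_mollify b hui hGi (1, 0)
  refine (congrArg enorm hid).le.trans ((hest w Φ (L * M) hpar.memLp_deriv.1 hΦM).trans ?_)
  rw [mul_comm]
  gcongr

end Estimates

/-! ### The pairing of the decomposition with the test function `ζ H(v)`. -/

section Estimates

variable {p q : ℝ≥0∞} [Fact (1 ≤ p)]

local notation "H" => Real.smoothTransition

theorem eLpNorm_spaceGradient_mulTest_le {L Z : ℝ} (hL0 : 0 ≤ L) (hZ0 : 0 ≤ Z)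
    (hL : ∀ s, |H s| ≤ L * |s|) (hL' : ∀ s, |deriv H s| ≤ L) (hp1 : 1 ≤ p) (hp : p ≠ ⊤)
    {ζ : 𝓓(cylinder T Ω, ℝ)} (hζ : ∀ z, |ζ z| ≤ 1) (hZ : ∀ z, ‖spaceGradient ζ z‖ ≤ Z)
    {b : ContDiffBump (0 : ℝ × Euc N)}
    (hb : ∀ z ∈ tsupport ζ, Metric.closedBall z (2 * b.rOut) ⊆ cylinder T Ω)
    {u : ℝ × Euc N → ℝ} {D : ℝ × Euc N → Euc N} (huw : HasWeakGradient T Ω u D)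
    (hu : Integrable u (cylinderMeasure T Ω)) (hD : Integrable D (cylinderMeasure T Ω)) :
    eLpNorm (spaceGradient (mulTest ζ
        (contDiff_smoothTransition.comp (contDiff_mollify_cylinder b hu)))) p
        (cylinderMeasure T Ω) ≤
      ENNReal.ofReal L * eLpNorm D p (cylinderMeasure T Ω) +
        ENNReal.ofReal (L * Z) * eLpNorm u p (cylinderMeasure T Ω) := by
  refine (eLpNorm_le_of_norm_le_add hp1
    (continuous_mollify b.continuous_normed b.hasCompactSupport_normed
      hD.locallyIntegrable).aestronglyMeasurable
    (contDiff_mollify_cylinder b hu).continuous.aestronglyMeasurable hL0 (mul_nonneg hL0 hZ0)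
    (Eventually.of_forall fun z => (norm_spaceGradient_mulTest_le b hL0
      contDiff_smoothTransition hL' hζ hb huw hu hD z).trans ?_)).trans
    (add_le_add (mul_le_mul_right (eLpNorm_mollify_cylinder_le b hD.1 hp1 hp) _)
      (mul_le_mul_right (eLpNorm_mollify_cylinder_le b hu.1 hp1 hp) _))
  refine add_le_add_right ((mul_le_mul (hL _) (hZ z) (norm_nonneg _)
    (mul_nonneg hL0 (abs_nonneg _))).trans_eq ?_) _
  rw [Real.norm_eq_abs]
  ring

theorem eLpNorm_mulTest_le {L : ℝ} (hL : ∀ s, |H s| ≤ L * |s|) (hp1 : 1 ≤ p) (hp : p ≠ ⊤)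
    {ζ : 𝓓(cylinder T Ω, ℝ)} (hζ : ∀ z, |ζ z| ≤ 1)
    {b : ContDiffBump (0 : ℝ × Euc N)} {u : ℝ × Euc N → ℝ}
    (hu : Integrable u (cylinderMeasure T Ω)) :
    eLpNorm (mulTest ζ (contDiff_smoothTransition.comp (contDiff_mollify_cylinder b hu))) p
        (cylinderMeasure T Ω) ≤ ENNReal.ofReal L * eLpNorm u p (cylinderMeasure T Ω) := by
  refine (eLpNorm_le_mul_eLpNorm_of_ae_le_mul (Eventually.of_forall fun z => ?_) p).trans
    (mul_le_mul_right (eLpNorm_mollify_cylinder_le b hu.1 hp1 hp) _)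
  rw [mulTest_apply, norm_mul]
  exact (mul_le_mul (hζ z) (hL _) (abs_nonneg _) zero_le_one).trans_eq (one_mul _)

theorem timeDeriv_mulTest {ζ : 𝓓(cylinder T Ω, ℝ)} {h : ℝ → ℝ} {v : ℝ × Euc N → ℝ}
    (hh : ContDiff ℝ ∞ h) (hv : ContDiff ℝ ∞ v) (z : ℝ × Euc N) :
    timeDeriv (mulTest ζ (hh.comp hv)) z =
      timeDeriv ζ z * h (v z) + ζ z * deriv h (v z) * fderiv ℝ v z (1, 0) := by
  rw [timeDeriv_eq_fderiv, timeDeriv_eq_fderiv]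
  have h₁ : DifferentiableAt ℝ ζ z := ζ.contDiff.differentiable (by simp) z
  have h₂ : DifferentiableAt ℝ (fun y => h (v y)) z := (hh.comp hv).differentiable (by simp) z
  have e : fderiv ℝ (mulTest ζ (hh.comp hv)) z =
      ζ z • fderiv ℝ (fun y => h (v y)) z + h (v z) • fderiv ℝ ζ z := fderiv_fun_mul h₁ h₂
  have e' : fderiv ℝ (mulTest ζ (hh.comp hv)) z (1, 0) =
      ζ z * fderiv ℝ (fun y => h (v y)) z (1, 0) + h (v z) * fderiv ℝ ζ z (1, 0) := by
    rw [e]; rfl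
  rw [e', fderiv_comp_real hh hv]
  ring

theorem Integrable.mul_of_hasCompactSupport {f k : ℝ × Euc N → ℝ} {m : Measure (ℝ × Euc N)}
    (hf : Integrable f m) (hk : Continuous k) (hkc : HasCompactSupport k) :
    Integrable (fun z => f z * k z) m := by
  obtain ⟨C, hC⟩ := hkc.exists_bound_of_continuous hk
  exact hf.mul_bdd hk.aestronglyMeasurable (Eventually.of_forall hC)

/-- The parts of the pairing of `f + g_t + χ` with the test function `ζ H(v)`. -/
theorem IsDecomposition.integral_mulTest {μ : SignedMeasure (ℝ × Euc N)} {f g : ℝ × Euc N → ℝ}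
    {χ : ℝ → StrongDual ℝ (SobolevZero Ω p)} (hμ : IsDecomposition T Ω p μ f g χ)
    (hg : Integrable g (cylinderMeasure T Ω)) (ζ : 𝓓(cylinder T Ω, ℝ)) {v : ℝ × Euc N → ℝ}
    (hv : ContDiff ℝ ∞ v) :
    ∫ᵛ z, ζ z * H (v z) ∂•μ =
      ∫ z, f z * (ζ z * H (v z)) ∂cylinderMeasure T Ω
        - ∫ z, g z * timeDeriv ζ z * H (v z) ∂cylinderMeasure T Ω
        - ∫ z, ζ z * deriv H (v z) * g z * fderiv ℝ v z (1, 0) ∂cylinderMeasure T Ω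
        + ∫ t, χ t (testInSobolevZero p
            (slice (mulTest ζ (contDiff_smoothTransition.comp hv)) t)) ∂timeMeasure T := by
  have h := hμ (mulTest ζ (contDiff_smoothTransition.comp hv))
  have hv' : Continuous fun z => fderiv ℝ v z (1, 0) :=
    (hv.continuous_fderiv (by simp)).clm_apply continuous_const
  have hζt : Continuous (timeDeriv ζ) := by
    rw [funext (timeDeriv_eq_fderiv ζ)]; exact continuous_fderiv_test ζ _
  have hζc : HasCompactSupport (timeDeriv ζ) := by
    rw [funext (timeDeriv_eq_fderiv ζ)]; exact ζ.hasCompactSupport.fderiv_apply ℝ _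
  have i₁ : Integrable (fun z => g z * timeDeriv ζ z * H (v z)) (cylinderMeasure T Ω) := by
    simp only [mul_assoc]
    exact Integrable.mul_of_hasCompactSupport hg
      (hζt.mul (Real.smoothTransition.continuous.comp hv.continuous)) hζc.mul_right
  have i₂ : Integrable (fun z => ζ z * deriv H (v z) * g z * fderiv ℝ v z (1, 0))
      (cylinderMeasure T Ω) := by
    refine (Integrable.mul_of_hasCompactSupport hg ((ζ.continuous.mul
      (contDiff_deriv_smoothTransition.continuous.comp hv.continuous)).mul hv')
      ζ.hasCompactSupport.mul_right.mul_right).congr (Eventually.of_forall fun z => ?_)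
    change g z * (ζ z * deriv H (v z) * fderiv ℝ v z (1, 0)) = _
    ring
  have e : ∫ z, g z * timeDeriv (mulTest ζ (contDiff_smoothTransition.comp hv)) z
      ∂cylinderMeasure T Ω = ∫ z, g z * timeDeriv ζ z * H (v z) ∂cylinderMeasure T Ω
        + ∫ z, ζ z * deriv H (v z) * g z * fderiv ℝ v z (1, 0) ∂cylinderMeasure T Ω := by
    rw [← integral_add i₁ i₂]
    refine integral_congr_ae (Eventually.of_forall fun z => ?_)
    simp only [timeDeriv_mulTest contDiff_smoothTransition hv]
    ring
  rw [e] at h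
  refine h.trans ?_
  simp only [mulTest_apply, Function.comp_apply]
  ring

theorem enorm_sub_sub_add_le (a b c d : ℝ) :
    ‖a - b - c + d‖ₑ ≤ ‖a‖ₑ + ‖b‖ₑ + ‖c‖ₑ + ‖d‖ₑ := by
  refine (enorm_add_le _ _).trans (add_le_add_left ?_ _)
  refine enorm_sub_le.trans (add_le_add_left enorm_sub_le _)

/-- Every term is linear in the norms of `U` and `w`, except the one with `f`: integrability of `f`
alone gives no pairing with `L^p`, so the part of `f` not captured by a simple function leaves the
additive error `δ`. -/
theorem IsDecomposition.exists_enorm_integral_le {μ : SignedMeasure (ℝ × Euc N)}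
    {f g : ℝ × Euc N → ℝ} {χ : ℝ → StrongDual ℝ (SobolevZero Ω p)}
    (hμ : IsDecomposition T Ω p μ f g χ) (hp1 : 1 < p) (hp : p ≠ ⊤)
    (hpq : ENNReal.HolderConjugate p q) [IsFiniteMeasure (spaceMeasure Ω)]
    (hf : MemLp f 1 (cylinderMeasure T Ω)) (hg : MemBochnerV T Ω p g)
    (hg' : MemLp g ⊤ (cylinderMeasure T Ω)) (hχ : MemLp χ q (timeMeasure T))
    {ζ : 𝓓(cylinder T Ω, ℝ)} (hζ : ∀ z, |ζ z| ≤ 1) {δ : ℝ≥0∞} (hδ : δ ≠ 0) :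
    ∃ C : ℝ≥0∞, C ≠ ⊤ ∧ ∀ (b : ContDiffBump (0 : ℝ × Euc N)) (u : ℝ × Euc N → ℝ)
      (U : ℝ → EnergySpace Ω p) (w : ℝ → StrongDual ℝ (EnergySpace Ω p)),
      (∀ z ∈ tsupport ζ, Metric.closedBall z (2 * b.rOut) ⊆ cylinder T Ω) →
      IsParabolicFunction T Ω p q u U w → eLpNorm U p (timeMeasure T) ≤ 1 →
      ‖∫ᵛ z, ζ z * H (mollify (b.normed volume) (cylinderMeasure T Ω) u z) ∂•μ‖ₑ ≤
        δ + C * (eLpNorm U p (timeMeasure T) + eLpNorm w q (timeMeasure T)) := by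
  have : IsFiniteMeasure (cylinderMeasure T Ω) := by
    rw [cylinderMeasure_eq_prod]; infer_instance
  obtain ⟨L, hL0, hL, hL', hL''⟩ := smoothTransition_bounds
  obtain ⟨Z, hZ0, hZ⟩ := exists_bound_test ζ
  obtain ⟨Ug, hUg⟩ := hg
  obtain ⟨hgn, Dg, hDgm, hDgn, hgw⟩ := hUg.exists_hasWeakGradient (q := q) hp
  have hgL : MemLp g p (cylinderMeasure T Ω) := ⟨hg'.1, hgn.trans_lt hUg.memLp.2⟩
  have hDgL : MemLp Dg p (cylinderMeasure T Ω) := ⟨hDgm, hDgn.trans_lt hUg.memLp.2⟩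
  obtain ⟨M, hM0, hgM⟩ : ∃ M : ℝ, 0 ≤ M ∧ ∀ᵐ z ∂cylinderMeasure T Ω, ‖g z‖ ≤ M := by
    refine ⟨(eLpNorm g ⊤ (cylinderMeasure T Ω)).toReal, ENNReal.toReal_nonneg, ?_⟩
    filter_upwards [ae_le_eLpNormEssSup (f := g) (μ := cylinderMeasure T Ω)] with z hz
    rw [← toReal_enorm]
    exact ENNReal.toReal_mono hg'.eLpNorm_ne_top (by rwa [eLpNorm_exponent_top])
  obtain ⟨C₀, hC₀, htime⟩ := exists_enorm_integral_timeDeriv_le hL0 hM0 hL' hL'' hp1 hp hpq hζ hgL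
    hDgL hgw hgM
  -- `s` is bounded, so `s ζ` lies in `L^q` and pairs with `H(v)`; the remainder `f - s` only sees
  -- `|ζ H(v)| ≤ 1`.
  obtain ⟨s, hs, -⟩ := hf.exists_simpleFunc_eLpNorm_sub_lt ENNReal.one_ne_top hδ
  have hζs : MemLp (fun z => s z * ζ z) q (cylinderMeasure T Ω) := by
    refine (s.memLp_of_isFiniteMeasure q _).of_le
      (s.aestronglyMeasurable.mul ζ.continuous.aestronglyMeasurable)
      (Eventually.of_forall fun z => ?_)
    rw [norm_mul]
    exact (mul_le_mul_of_nonneg_left (hζ z) (norm_nonneg _)).trans_eq (mul_one _)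
  have hζt : Continuous (timeDeriv ζ) := by
    rw [funext (timeDeriv_eq_fderiv ζ)]; exact continuous_fderiv_test ζ _
  have hζc : HasCompactSupport (timeDeriv ζ) := by
    rw [funext (timeDeriv_eq_fderiv ζ)]; exact ζ.hasCompactSupport.fderiv_apply ℝ _
  have hζg : MemLp (fun z => g z * timeDeriv ζ z) q (cylinderMeasure T Ω) := by
    obtain ⟨B, hB⟩ := hζc.exists_bound_of_continuous hζt
    refine MemLp.of_bound (hg'.1.mul hζt.aestronglyMeasurable) (M * B) ?_
    filter_upwards [hgM] with z hz
    rw [norm_mul]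
    exact mul_le_mul hz (hB z) (norm_nonneg _) hM0
  set S := eLpNorm (fun z => s z * ζ z) q (cylinderMeasure T Ω) with hS
  set G := eLpNorm (fun z => g z * timeDeriv ζ z) q (cylinderMeasure T Ω) with hG
  set X := eLpNorm χ q (timeMeasure T) with hX
  have hS' : S ≠ ⊤ := hζs.eLpNorm_ne_top
  have hG' : G ≠ ⊤ := hζg.eLpNorm_ne_top
  have hX' : X ≠ ⊤ := hχ.eLpNorm_ne_top
  set l := ENNReal.ofReal L with hl
  -- One constant for all four terms: `S` for the simple part of `f`, `G` for `g ζ_t`, `C₀` for the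
  -- time derivative, and `X` for `χ` against the `L^p` and gradient norms of `ζ H(v)`.
  refine ⟨l * S + l * G + C₀ + X * (l + (l + ENNReal.ofReal (L * Z))), by finiteness, ?_⟩
  intro b u U w hb hpar hU1
  obtain ⟨hun, D, hDm, hDn, huw⟩ := hpar.curve.exists_hasWeakGradient (q := q) hp
  have huL : MemLp u p (cylinderMeasure T Ω) :=
    ⟨hpar.curve.aestronglyMeasurable, hun.trans_lt hpar.curve.memLp.2⟩
  have hDL : MemLp D p (cylinderMeasure T Ω) := ⟨hDm, hDn.trans_lt hpar.curve.memLp.2⟩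
  have hui := huL.integrable hp1.le
  have hDi := hDL.integrable hp1.le
  have hgi := hgL.integrable hp1.le
  have hvs := contDiff_mollify_cylinder b hui
  set v := mollify (b.normed volume) (cylinderMeasure T Ω) u with hv
  rw [hμ.integral_mulTest hgi ζ hvs]
  set a := eLpNorm U p (timeMeasure T) with ha
  set c := eLpNorm w q (timeMeasure T) with hc
  have b₁ : ‖∫ z, f z * (ζ z * H (v z)) ∂cylinderMeasure T Ω‖ₑ ≤ δ + l * S * a := by
    have hζH : ∀ z, ‖ζ z * H (v z)‖ ≤ 1 := fun z => by
      rw [norm_mul, Real.norm_of_nonneg (Real.smoothTransition.nonneg _)]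
      exact mul_le_one₀ (hζ z) (Real.smoothTransition.nonneg _) (Real.smoothTransition.le_one _)
    have hζHc : Continuous fun z => ζ z * H (v z) :=
      ζ.continuous.mul (Real.smoothTransition.continuous.comp hvs.continuous)
    have hs1 : Integrable s (cylinderMeasure T Ω) :=
      (s.memLp_of_isFiniteMeasure 1 _).integrable le_rfl
    have hf1 : Integrable f (cylinderMeasure T Ω) := hf.integrable le_rfl
    have j₁ : Integrable (fun z => (f z - s z) * (ζ z * H (v z))) (cylinderMeasure T Ω) :=
      (hf1.sub hs1).mul_bdd hζHc.aestronglyMeasurable (Eventually.of_forall hζH)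
    have j₂ : Integrable (fun z => s z * (ζ z * H (v z))) (cylinderMeasure T Ω) :=
      hs1.mul_bdd hζHc.aestronglyMeasurable (Eventually.of_forall hζH)
    have e : ∫ z, f z * (ζ z * H (v z)) ∂cylinderMeasure T Ω =
        ∫ z, (f z - s z) * (ζ z * H (v z)) ∂cylinderMeasure T Ω +
          ∫ z, s z * ζ z * H (v z) ∂cylinderMeasure T Ω := by
      simp only [mul_assoc]
      rw [← integral_add j₁ j₂]
      refine integral_congr_ae (Eventually.of_forall fun z => ?_)
      simp only
      ring
    rw [e]
    refine (enorm_add_le _ _).trans (add_le_add ?_ ?_)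
    · refine (enorm_integral_le_lintegral_enorm _).trans (le_trans ?_ hs.le)
      rw [eLpNorm_one_eq_lintegral_enorm]
      refine lintegral_mono fun z => ?_
      rw [enorm_le_iff_norm_le, norm_mul]
      exact (mul_le_mul_of_nonneg_left (hζH z) (norm_nonneg _)).trans_eq (mul_one _)
    · refine (enorm_integral_mul_smoothTransition_le b hL hp1.le hp hpq huL.1 hui hζs.1).trans ?_
      gcongr
  have b₂ : ‖∫ z, g z * timeDeriv ζ z * H (v z) ∂cylinderMeasure T Ω‖ₑ ≤ l * G * a := by
    refine (enorm_integral_mul_smoothTransition_le b hL hp1.le hp hpq huL.1 hui hζg.1).trans ?_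
    gcongr
  have b₃ := htime b u D U w hb hpar huL hDL huw (hDn.trans hU1)
  have b₄ : ‖∫ t, χ t (testInSobolevZero p
      (slice (mulTest ζ (contDiff_smoothTransition.comp hvs)) t)) ∂timeMeasure T‖ₑ ≤
      X * (l * a + (l * a + ENNReal.ofReal (L * Z) * a)) := by
    refine (enorm_integral_sobolevZero_le hp1 hp hpq hχ.1 _).trans ?_
    refine mul_le_mul_right (add_le_add ((eLpNorm_mulTest_le hL hp1.le hp hζ hui).trans ?_)
      ((eLpNorm_spaceGradient_mulTest_le hL0 hZ0 hL hL' hp1.le hp hζ hZ hb huw hui hDi).trans ?_)) _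
    · gcongr
    · gcongr
  refine (enorm_sub_sub_add_le _ _ _ _).trans ((add_le_add (add_le_add (add_le_add b₁ b₂) b₃)
    b₄).trans ?_)
  calc _ = δ + ((l * S + l * G + X * (l + (l + ENNReal.ofReal (L * Z)))) * a + C₀ * c) := by ring
    _ ≤ δ + ((l * S + l * G + C₀ + X * (l + (l + ENNReal.ofReal (L * Z)))) * a +
        (l * S + l * G + C₀ + X * (l + (l + ENNReal.ofReal (L * Z)))) * c) := by
      refine add_le_add le_rfl (add_le_add (mul_le_mul_left ?_ _) (mul_le_mul_left ?_ _))
      · rw [add_right_comm _ C₀]; exact le_self_add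
      · exact le_add_self.trans le_self_add
    _ = _ := by ring

end Estimates

/-! ### Comparing `μ K` with the integral of a test function. -/

theorem exists_test_eq_one {K V : Set (ℝ × Euc N)} (hK : IsCompact K) (hV : IsOpen V)
    (hKV : K ⊆ V) (hVQ : V ⊆ cylinder T Ω) :
    ∃ ζ : 𝓓(cylinder T Ω, ℝ), (∀ z, 0 ≤ ζ z) ∧ (∀ z, ζ z ≤ 1) ∧ (∀ z ∈ K, ζ z = 1) ∧
      tsupport ζ ⊆ V := by
  obtain ⟨ε, hε, hεV⟩ := hK.exists_cthickening_subset_open hV hKV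
  obtain ⟨g, hg, hr, hs, h1⟩ := exists_contMDiff_support_eq_eq_one_iff
    (modelWithCornersSelf ℝ (ℝ × Euc N)) (Metric.isOpen_thickening (δ := ε) (E := K))
    hK.isClosed (Metric.self_subset_thickening hε K)
  have hts : tsupport g ⊆ Metric.cthickening ε K := by
    rw [tsupport, hs]; exact Metric.closure_thickening_subset_cthickening ε K
  refine ⟨⟨g, contMDiff_iff_contDiff.1 hg, hK.cthickening.of_isClosed_subset
    (isClosed_tsupport g) hts, hts.trans (hεV.trans hVQ)⟩, fun z => ?_, fun z => ?_, fun z hz => ?_,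
    hts.trans hεV⟩
  · exact (hr (mem_range_self z)).1
  · exact (hr (mem_range_self z)).2
  · exact (h1 z).1 hz

/-- The kernel's ball around `z` lies in `O ⊆ Q`, so restricting to the cylinder loses none of its
unit mass and the average is over values at least 1. -/
theorem one_le_mollify {b : ContDiffBump (0 : ℝ × Euc N)} {u : ℝ × Euc N → ℝ}
    (hu : Integrable u (cylinderMeasure T Ω)) {O : Set (ℝ × Euc N)}
    (hO : O ⊆ cylinder T Ω) (h : ∀ᵐ z ∂cylinderMeasure T Ω, O.indicator 1 z ≤ u z)
    {z : ℝ × Euc N} (hz : Metric.closedBall z b.rOut ⊆ O) :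
    1 ≤ mollify (b.normed volume) (cylinderMeasure T Ω) u z := by
  have h0 : ∀ y, y ∉ O → b.normed volume (z - y) = 0 := by
    intro y hy
    have : z - y ∉ Function.support (b.normed volume) := by
      rw [b.support_normed_eq, mem_ball_zero_iff, ← dist_eq_norm, dist_comm]
      exact fun h => hy (hz (Metric.ball_subset_closedBall h))
    exact Function.notMem_support.1 this
  have hint : Integrable (fun y => b.normed volume (z - y)) volume :=
    b.integrable_normed.comp_sub_left z
  have e : ∫ y, b.normed volume (z - y) ∂cylinderMeasure T Ω = 1 := by
    rw [setIntegral_eq_integral_of_forall_compl_eq_zero fun y hy => h0 y fun h => hy (hO h),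
      integral_sub_left_eq_self (b.normed volume) volume z, b.integral_normed]
  rw [← e]
  refine integral_mono_ae hint.integrableOn (integrable_kernel_smul b.continuous_normed
    b.hasCompactSupport_normed hu.locallyIntegrable z) ?_
  filter_upwards [h] with y hy
  by_cases hyO : y ∈ O
  · rw [indicator_of_mem hyO, Pi.one_apply] at hy
    exact le_mul_of_one_le_right (b.nonneg_normed _) hy
  · simp [h0 y hyO]

/-- The difference between `φ` and the indicator of `K` vanishes on `K` and off `V`, and is at most
1 in absolute value in between. -/
theorem enorm_signedMeasure_le {X : Type*} [MeasurableSpace X] (μ : SignedMeasure X)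
    [IsFiniteMeasure μ.variation] {K V : Set X} (hK : MeasurableSet K) (hV : MeasurableSet V)
    {φ : X → ℝ} (hφ : Measurable φ) (h0 : ∀ z, 0 ≤ φ z) (h1 : ∀ z, φ z ≤ 1)
    (hφK : ∀ z ∈ K, φ z = 1) (hφV : ∀ z, z ∉ V → φ z = 0) :
    ‖μ K‖ₑ ≤ ‖∫ᵛ z, φ z ∂•μ‖ₑ + μ.variation (V \ K) := by
  have hφi : Integrable φ μ.variation := Integrable.of_bound hφ.aestronglyMeasurable 1
    (Eventually.of_forall fun z => by rw [Real.norm_of_nonneg (h0 z)]; exact h1 z)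
  have hKi : Integrable (K.indicator fun _ => (1 : ℝ)) μ.variation :=
    (integrable_const 1).indicator hK
  have e : μ K = ∫ᵛ z, φ z ∂•μ + ∫ᵛ z, (K.indicator (fun _ => (1 : ℝ)) z - φ z) ∂•μ := by
    rw [VectorMeasure.integral_fun_sub hKi hφi, VectorMeasure.integral_indicator_const _ hK]
    simp
  rw [e]
  refine (enorm_add_le _ _).trans (add_le_add_right ?_ _)
  refine VectorMeasure.enorm_integral_le_lintegral_enorm_transpose.trans ?_
  rw [VectorMeasure.variation_transpose_lsmul, ← lintegral_indicator_one (hV.diff hK)]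
  refine lintegral_mono fun z => ?_
  by_cases hzK : z ∈ K
  · simp [hzK, hφK z hzK]
  · by_cases hzV : z ∈ V
    · have : z ∈ V \ K := ⟨hzV, hzK⟩
      simp only [indicator_of_notMem hzK, indicator_of_mem this, zero_sub, enorm_neg, Pi.one_apply]
      rw [Real.enorm_of_nonneg (h0 z), ← ENNReal.ofReal_one]
      exact ENNReal.ofReal_le_ofReal (h1 z)
    · simp [hzK, hφV z hzV]

end ParabolicCapacity

end

/-! ### The contradiction. -/

theorem mainTheorem11 {N : ℕ} (T : ℝ) (hT : 0 < T)
    (Ω : TopologicalSpace.Opens (EuclideanSpace ℝ (Fin N)))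
    (hΩ : Bornology.IsBounded (Ω : Set (EuclideanSpace ℝ (Fin N))))
    (p q : ℝ≥0∞) [Fact (1 ≤ p)]
    (hp : 1 < p) (hp' : p ≠ ⊤) (hpq : ENNReal.HolderConjugate p q)
    -- a finite Radon measure on the cylinder, extended arbitrarily to the whole space
    (μ : SignedMeasure (ℝ × EuclideanSpace ℝ (Fin N)))
    -- `f ∈ L¹(Q)`
    (f : ℝ × EuclideanSpace ℝ (Fin N) → ℝ)
    (hf : MemLp f 1 (ParabolicCapacity.cylinderMeasure T Ω))
    -- `g ∈ L^p(0, T; V) ∩ L^∞(Q)`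
    (g : ℝ × EuclideanSpace ℝ (Fin N) → ℝ)
    (hg : ParabolicCapacity.MemBochnerV T Ω p g)
    (hg' : MemLp g ⊤ (ParabolicCapacity.cylinderMeasure T Ω))
    -- `χ ∈ L^q(0, T; W^{-1,q}(Ω))`, where `W^{-1,q}(Ω)` is the dual of `W₀^{1,p}(Ω)`
    (χ : ℝ → StrongDual ℝ (ParabolicCapacity.SobolevZero Ω p))
    (hχ : MemLp χ q (ParabolicCapacity.timeMeasure T))
    (hμ : ParabolicCapacity.IsDecomposition T Ω p μ f g χ) :
    ParabolicCapacity.IsDiffuse T Ω p q μ := by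
  open ParabolicCapacity in
  intro B hB hBQ hcap
  have hfin : IsFiniteMeasure (spaceMeasure Ω) := ⟨by
    rw [Measure.restrict_apply_univ]; exact hΩ.measure_lt_top⟩
  have hvar : IsFiniteMeasure μ.variation := by
    rw [← SignedMeasure.totalVariation_eq_variation]; infer_instance
  by_contra hne
  -- The regularity error is taken below `|μ B|`: if `μ K` vanished, `μ (B \ K)` would equal `μ B`,
  -- which is too large.
  obtain ⟨K, hKB, hK, hKd⟩ := hB.exists_isCompact_sdiff_lt (measure_ne_top μ.variation B)
    (enorm_ne_zero.2 hne)
  have hKm : MeasurableSet K := hK.isClosed.measurableSet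
  have hμK : μ K ≠ 0 := by
    intro h0
    have h1 := VectorMeasure.of_add_of_sdiff (v := μ) hKm hB hKB
    rw [h0, zero_add] at h1
    exact (h1 ▸ μ.enorm_measure_le_variation (B \ K)).not_gt hKd
  set a : ℝ≥0∞ := ‖μ K‖ₑ with ha
  have ha0 : a ≠ 0 := enorm_ne_zero.2 hμK
  have ha4 : a / 4 ≠ 0 := ENNReal.div_ne_zero.2 ⟨ha0, by norm_num⟩
  have ha4' : a / 4 ≠ ⊤ := ENNReal.div_ne_top enorm_ne_top (by norm_num)
  obtain ⟨V₀, hKV₀, hV₀, hV₀K⟩ := K.exists_isOpen_lt_add (measure_ne_top μ.variation K) ha4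
  set V : Set (ℝ × Euc N) := V₀ ∩ cylinder T Ω with hVdef
  have hV : IsOpen V := hV₀.inter (cylinder T Ω).isOpen
  have hKV : K ⊆ V := subset_inter hKV₀ (hKB.trans hBQ)
  have hVK : μ.variation (V \ K) ≤ a / 4 := by
    refine (measure_mono (sdiff_subset_sdiff_left inter_subset_left)).trans ?_
    rw [measure_sdiff hKV₀ hKm.nullMeasurableSet (measure_ne_top _ _)]
    exact tsub_le_iff_left.2 hV₀K.le
  obtain ⟨ζ, hζ0, hζ1, hζK, hζV⟩ := exists_test_eq_one hK hV hKV
    (inter_subset_right : V ⊆ cylinder T Ω)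
  have hζ : ∀ z, |ζ z| ≤ 1 := fun z => by rw [abs_of_nonneg (hζ0 z)]; exact hζ1 z
  obtain ⟨C, hC, hbound⟩ := hμ.exists_enorm_integral_le hp hp' hpq hf hg hg' hχ hζ ha4
  -- `η ≤ 1` provides the normalization that the uniform bound requires; dividing by `C + 1` instead
  -- of `C` covers `C = 0`.
  obtain ⟨η, hη0, hη⟩ : ∃ η : ℝ≥0∞, 0 < η ∧ η ≤ 1 ∧ C * η ≤ a / 4 := by
    refine ⟨min 1 (a / 4 / (C + 1)), lt_min one_pos (ENNReal.div_pos ha4 (by finiteness)),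
      min_le_left _ _, ?_⟩
    calc C * min 1 (a / 4 / (C + 1)) ≤ (C + 1) * (a / 4 / (C + 1)) :=
          mul_le_mul' le_self_add (min_le_right _ _)
      _ ≤ a / 4 := ENNReal.mul_div_le
  -- Reading `0 < η` as capacity below `η` extracts near-optimal `O` and `u` from the infima.
  rw [← hcap, capacity] at hη0
  simp only [iInf_lt_iff, openCapacity] at hη0
  obtain ⟨O, hO, hOQ, hBO, u, U, w, hpar, huO, hlt⟩ := hη0
  obtain ⟨ε₁, hε₁, hε₁K⟩ := hK.exists_cthickening_subset_open hO (hKB.trans hBO)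
  obtain ⟨ε₂, hε₂, hε₂ζ⟩ := ζ.hasCompactSupport.isCompact.exists_cthickening_subset_open
    (cylinder T Ω).isOpen ζ.tsupport_subset
  have hε : 0 < min ε₁ (ε₂ / 2) := lt_min hε₁ (half_pos hε₂)
  -- The radius is at most `ε₁`, so kernel balls centred in `K` stay in `O`, and at most `ε₂ / 2`,
  -- so doubled balls centred in the support of `ζ` stay in `Q`.
  let b : ContDiffBump (0 : ℝ × Euc N) :=
    ⟨min ε₁ (ε₂ / 2) / 2, min ε₁ (ε₂ / 2), half_pos hε, half_lt_self hε⟩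
  have hbK : ∀ z ∈ K, Metric.closedBall z b.rOut ⊆ O := fun z hz =>
    (Metric.closedBall_subset_closedBall (min_le_left _ _)).trans
      ((Metric.closedBall_subset_cthickening hz ε₁).trans hε₁K)
  have hbζ : ∀ z ∈ tsupport ζ, Metric.closedBall z (2 * b.rOut) ⊆ cylinder T Ω := fun z hz =>
    (Metric.closedBall_subset_closedBall (by
      have : b.rOut ≤ ε₂ / 2 := min_le_right _ _
      linarith)).trans ((Metric.closedBall_subset_cthickening hz ε₂).trans hε₂ζ)
  have hfinQ : IsFiniteMeasure (cylinderMeasure T Ω) := by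
    rw [cylinderMeasure_eq_prod]; infer_instance
  have hui : Integrable u (cylinderMeasure T Ω) := by
    have hun := (hpar.curve.exists_hasWeakGradient (q := q) hp').1
    exact MemLp.integrable hp.le ⟨hpar.curve.aestronglyMeasurable,
      hun.trans_lt hpar.curve.memLp.2⟩
  have hest := hbound b u U w hbζ hpar ((le_self_add.trans hlt.le).trans hη.1)
  have hvs := contDiff_mollify_cylinder b hui
  have hle := enorm_signedMeasure_le μ hKm hV.measurableSet
    (φ := fun z => ζ z * Real.smoothTransition
      (mollify (b.normed volume) (cylinderMeasure T Ω) u z))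
    (ζ.continuous.mul (Real.smoothTransition.continuous.comp hvs.continuous)).measurable
    (fun z => mul_nonneg (hζ0 z) (Real.smoothTransition.nonneg _))
    (fun z => mul_le_one₀ (hζ1 z) (Real.smoothTransition.nonneg _)
      (Real.smoothTransition.le_one _))
    (fun z hz => by
      simp only [hζK z hz, Real.smoothTransition.one_of_one_le
        (one_le_mollify hui hOQ huO (hbK z hz)), mul_one])
    (fun z hz => by
      simp only [image_eq_zero_of_notMem_tsupport fun h => hz (hζV h), zero_mul])
  -- The three quarters come from `δ`, from `C ‖u‖_W`, and from the variation of `μ` on `V \ K`.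
  have hfinal : a ≤ a / 4 + a / 4 + a / 4 :=
    hle.trans (add_le_add (hest.trans (add_le_add le_rfl
      ((mul_le_mul_right hlt.le C).trans hη.2))) hVK)
  have h4 : a / 4 + a / 4 + a / 4 + a / 4 = a := by
    calc a / 4 + a / 4 + a / 4 + a / 4 = a / 4 * 4 := by ring
      _ = a := ENNReal.div_mul_cancel (by norm_num) (by norm_num)
  have : a / 4 + a / 4 + a / 4 < a := by
    conv_rhs => rw [← h4]
    exact ENNReal.lt_add_right (by finiteness) ha4
  exact this.not_ge hfinal
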